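/- Let $K=\mathbb{F}_q$ be a finite field with $q$ elements, $q$ odd. Let $\Phi$ be the set of monic irreducible polynomials in $K[x]$ different from $x$, write $d(f)=\deg f$, and for $f\in\Phi$ let $f^*(x)=f(0)^{-1}x^{d(f)}f(1/x)\in\Phi$ be its monic reciprocal polynomial. Let $\Lambda$ be the set of all integer partitions (including the empty one), and write $|\lambda|$ for the size of $\lambda\in\Lambda$. For $n\ge 0$ let $\mathfrak{Y}_n$ be the (finite) set of functions $\boldsymbol\mu:\Phi\to\Lambda$, with $\boldsymbol\mu(f)=\emptyset$ for all but finitely many $f$, such that $$\sum_{f\in\Phi} d(f)\,|\boldsymbol\mu(f)|=n\qquad\text{and}\qquad \boldsymbol\mu(f)=\boldsymbol\mu(f^*)\ \text{ for all } f\in\Phi .$$ For $\boldsymbol\mu\in\mathfrak{Y}_n$ put $$d_{\boldsymbol\mu}=\prod_{i=1}^n(q^i-1)\ \prod_{f\in\Phi}H\bigl(\boldsymbol\mu(f),q^{d(f)}\bigr),\qquad H(\lambda,x)=x^{\alpha(\lambda)}\prod_{h}\bigl(x^{|h|}-1\bigr)^{-1},\qquad \alpha(\lambda)=\sum_i (i-1)\lambda_i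 ,$$ where $h$ runs over the hooks of $\lambda$ and $|h|$ is the hook length. Let $\mathscr{G}_n(\Phi)$ be the set of finitely supported functions $F:\Phi\to\mathbb{Z}_{\ge 0}$ with $\sum_{f} d(f)F(f)=n$ and $F(f^*)=F(f)$ for all $f$; for $\boldsymbol\mu\in\mathfrak{Y}_n$ write $\boldsymbol\mu\mapsto F$ if $|\boldsymbol\mu(f)|=F(f)$ for all $f\in\Phi$. Let $v_2$ be the $2$-adic valuation on $\mathbb{Q}$ and $(n)_k=n(n-1)\cdots(n-k+1)$ (so $(n)_k=n!/(n-k)!$ for $n\ge k$). Then for every integer $k\ge 0$: 1. For every $\varepsilon>0$ there is $N$ such that for all $n\ge N$ and all $F\in\mathscr{G}_n(\Phi)$, $$\frac{\#\{\boldsymbol\mu\in\mathfrak{Y}_n : \boldsymbol\mu\mapsto F,\ v_2(d_{\boldsymbol\mu})<v_2((n)_k)\}}{\#\{\boldsymbol\mu\in\mathfrak{Y}_n : \boldsymbol\mu\mapsto F\}}<\varepsilon .$$ 2. $$\lim_{n\to\infty}\frac{\#\{\boldsymbol\mu\in\mathfrak{Y}_n : v_2(d_{\boldsymbol\mu})<v_2((n)_k)\}}{|\mathfrak{Y}_n|}=0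 .$$ -/

import Mathlib

namespace GreenGL

open Polynomial

/-- The set `Φ` of monic irreducible polynomials over `K` other than `X`. -/
def Phi (K : Type*) [Field K] : Type _ :=
  {f : K[X] // f.Monic ∧ Irreducible f ∧ f ≠ X}

/-- The degree `d(f)` of an element of `Φ`. -/
noncomputable def Phi.deg {K : Type*} [Field K] (f : Phi K) : ℕ := f.1.natDegree

theorem Phi.coeff_zero_ne {K : Type*} [Field K] (f : Phi K) : f.1.coeff 0 ≠ 0 := by
  intro h
  obtain ⟨hm, hi, hX⟩ := f.2
  have hd : X ∣ f.1 := X_dvd_iff.mpr h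
  exact hX (eq_of_monic_of_associated hm monic_X
    ((irreducible_X.associated_of_dvd hi hd).symm))

theorem irreducible_reverse {K : Type*} [Field K] {p : K[X]} (hp : Irreducible p)
    (h0 : p.coeff 0 ≠ 0) : Irreducible p.reverse := by
  have hrr : ∀ r : K[X], r.coeff 0 ≠ 0 → r.reverse.natDegree = r.natDegree := by
    intro r hr
    rw [reverse_natDegree, natTrailingDegree_eq_zero.mpr (Or.inr hr), Nat.sub_zero]
  have hpr : p.reverse.reverse = p := by
    have h1 := hrr p h0
    ext i
    rw [coeff_reverse, coeff_reverse, h1, revAt_invol]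
  have hpos : 0 < p.natDegree := hp.natDegree_pos
  refine ⟨fun hu => ?_, fun a b hab => ?_⟩
  · have := natDegree_eq_zero_of_isUnit hu
    rw [hrr p h0] at this
    omega
  · have hc : p.reverse.coeff 0 ≠ 0 := by
      rw [coeff_zero_reverse]
      exact leadingCoeff_ne_zero.mpr hp.ne_zero
    have hab0 : a.coeff 0 * b.coeff 0 ≠ 0 := by
      rwa [hab, mul_coeff_zero] at hc
    have ha : a.coeff 0 ≠ 0 := left_ne_zero_of_mul hab0
    have hb : b.coeff 0 ≠ 0 := right_ne_zero_of_mul hab0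
    have key : p = a.reverse * b.reverse := by
      rw [← reverse_mul_of_domain, ← hab, hpr]
    have hu : ∀ r : K[X], r.coeff 0 ≠ 0 → IsUnit r.reverse → IsUnit r := by
      intro r hr h
      have h1 := natDegree_eq_zero_of_isUnit h
      rw [hrr r hr] at h1
      rw [eq_C_of_natDegree_eq_zero h1]
      exact (isUnit_C).mpr (Ne.isUnit hr)
    exact (hp.isUnit_or_isUnit key).imp (hu a ha) (hu b hb)

/-- The monic reciprocal polynomial `f*(X) = f(0)⁻¹ X ^ d(f) f(1/X)`: its roots are the inverses of
the roots of `f`. -/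
noncomputable def Phi.dual {K : Type*} [Field K] (f : Phi K) : Phi K :=
  ⟨C (f.1.coeff 0)⁻¹ * f.1.reverse, by
    have h0 := f.coeff_zero_ne
    have hu : IsUnit (C (f.1.coeff 0)⁻¹) := isUnit_C.mpr (Ne.isUnit (inv_ne_zero h0))
    have hlead : f.1.reverse.leadingCoeff = f.1.coeff 0 := by
      rw [reverse_leadingCoeff, trailingCoeff,
        natTrailingDegree_eq_zero.mpr (Or.inr h0)]
    refine ⟨?_, ?_, ?_⟩
    · rw [Monic, leadingCoeff_mul, leadingCoeff_C, hlead, inv_mul_cancel₀ h0]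
    · exact (irreducible_isUnit_mul hu).mpr (irreducible_reverse f.2.2.1 h0)
    · intro h
      have h1 := congrArg (fun p : K[X] => p.coeff 0) h
      simp only [mul_coeff_zero, coeff_C_zero, coeff_zero_reverse, coeff_X_zero,
        f.2.1.leadingCoeff, mul_one] at h1
      exact inv_ne_zero h0 h1⟩

/-- `F : Φ → ℕ` has finite support and `∑_f d(f) F(f) = n`. -/
def HasWeight {K : Type*} [Field K] (n : ℕ) (F : Phi K → ℕ) : Prop :=
  F.support.Finite ∧ ∑ᶠ f : Phi K, f.deg * F f = n

/-- The set `𝔛_n` of partition-valued functions `μ` on `Φ` with `∑_f d(f) |μ(f)| = n`.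
Partitions are represented by their Young diagrams; the size of a partition is the number of cells
and its parts are the row lengths. -/
def partFuns (K : Type*) [Field K] (n : ℕ) : Set (Phi K → YoungDiagram) :=
  {μ | HasWeight n (fun f => (μ f).card)}

/-- The set `𝔜_n` of self-dual elements of `𝔛_n`. -/
def selfDual (K : Type*) [Field K] (n : ℕ) : Set (Phi K → YoungDiagram) :=
  {μ | μ ∈ partFuns K n ∧ ∀ f, μ f = μ f.dual}

/-- The set `𝒢_n(Φ)` of self-dual types `F`. -/
def types (K : Type*) [Field K] (n : ℕ) : Set (Phi K → ℕ) :=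
  {F | HasWeight n F ∧ ∀ f, F f.dual = F f}

/-- The fibre of the map sending `μ ∈ 𝔜_n` to its type `f ↦ |μ(f)|`. -/
def fiber {K : Type*} [Field K] (n : ℕ) (F : Phi K → ℕ) : Set (Phi K → YoungDiagram) :=
  {μ | μ ∈ selfDual K n ∧ ∀ f, (μ f).card = F f}

/-- `α(λ) = ∑_i (i - 1) λ_i` (rows are numbered from `0` here). -/
def alpha (l : YoungDiagram) : ℕ := ∑ i ∈ Finset.range (l.colLen 0), i * l.rowLen i

/-- The hook length `|h|` of the cell `c` of `l`: arm length plus leg length plus one. -/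
def hookLength (l : YoungDiagram) (c : ℕ × ℕ) : ℕ :=
  (l.rowLen c.1 - (c.2 + 1)) + (l.colLen c.2 - (c.1 + 1)) + 1

/-- `H(λ, x) = x ^ α(λ) ∏_h (x ^ |h| - 1)⁻¹`, the product over the hooks of `λ`. -/
def hookFactor (l : YoungDiagram) (x : ℚ) : ℚ :=
  x ^ alpha l * ∏ c ∈ l.cells, (x ^ hookLength l c - 1)⁻¹

/-- `ψ_n(q) = ∏_{i=1}^n (q ^ i - 1)`. -/
def psi (n : ℕ) (x : ℚ) : ℚ := ∏ i ∈ Finset.Icc 1 n, (x ^ i - 1)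

/-- Green's degree expression `d_μ = ψ_n(q) ∏_f H(μ(f), q ^ d(f))`, with `q = |K|`. -/
noncomputable def greenDegree {K : Type*} [Field K] (n : ℕ) (μ : Phi K → YoungDiagram) : ℚ :=
  psi n (Nat.card K) * ∏ᶠ f : Phi K, hookFactor (μ f) ((Nat.card K : ℚ) ^ f.deg)

/-- `v_2(d_μ) < v_2((n)_k)`, where `(n)_k = n! / (n - k)!`. -/
def IsBad {K : Type*} [Field K] (n k : ℕ) (μ : Phi K → YoungDiagram) : Prop :=
  padicValRat 2 (greenDegree n μ) < padicValRat 2 (n.descFactorial k : ℚ)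

theorem Phi.deg_pos {K : Type*} [Field K] (f : Phi K) : 0 < f.deg := f.2.2.1.natDegree_pos

theorem HasWeight.le {K : Type*} [Field K] {n : ℕ} {F : Phi K → ℕ} (h : HasWeight n F)
    (f : Phi K) : f.deg * F f ≤ n := by
  rw [← h.2]
  refine single_le_finsum (f := fun g : Phi K => g.deg * F g) f (h.1.subset ?_)
    (fun _ => Nat.zero_le _)
  intro g hg
  exact right_ne_zero_of_mul (Function.mem_support.mp hg)

theorem finite_deg_le (K : Type*) [Field K] [Finite K] (n : ℕ) :
    {f : Phi K | f.deg ≤ n}.Finite := by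
  have h : Finite (degreeLT K (n + 1)) := Finite.of_equiv _ (degreeLTEquiv K (n + 1)).symm.toEquiv
  have h2 : ((degreeLT K (n + 1) : Submodule K K[X]) : Set K[X]).Finite := Set.toFinite _
  refine Set.Finite.of_finite_image (h2.subset ?_) (Subtype.val_injective.injOn)
  rintro _ ⟨f, hf, rfl⟩
  rw [SetLike.mem_coe, mem_degreeLT]
  exact lt_of_le_of_lt degree_le_natDegree (by exact_mod_cast Nat.lt_succ_of_le hf)

theorem finite_card_le (n : ℕ) : {l : YoungDiagram | l.card ≤ n}.Finite := by
  refine Set.Finite.of_finite_image (f := YoungDiagram.cells)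
    ((Finset.finite_toSet (Finset.range n ×ˢ Finset.range n).powerset).subset ?_)
    (fun a _ b _ h => YoungDiagram.ext h)
  rintro _ ⟨l, hl, rfl⟩
  rw [Finset.mem_coe, Finset.mem_powerset]
  rintro ⟨i, j⟩ hc
  have hc' : (i, j) ∈ l := hc
  have h1 : l.rowLen i ≤ l.card := by
    rw [l.rowLen_eq_card]; exact Finset.card_le_card (Finset.filter_subset _ _)
  have h2 : l.colLen j ≤ l.card := by
    rw [l.colLen_eq_card]; exact Finset.card_le_card (Finset.filter_subset _ _)
  have h3 := YoungDiagram.mem_iff_lt_rowLen.mp hc'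
  have h4 := YoungDiagram.mem_iff_lt_colLen.mp hc'
  have hl' : l.card ≤ n := hl
  simp only [Finset.mem_product, Finset.mem_range]
  omega

/-- `𝔛_n` is finite when `K` is, so the cardinalities of its subsets are genuine. -/
theorem finite_partFuns (K : Type*) [Field K] [Finite K] (n : ℕ) : (partFuns K n).Finite := by
  have hD : Finite {f : Phi K | f.deg ≤ n} := finite_deg_le K n
  have hS : Finite {l : YoungDiagram | l.card ≤ n} := finite_card_le n
  have hb : ∀ μ ∈ partFuns K n, ∀ f, (μ f).card ≤ n := fun μ hμ f =>
    le_trans (Nat.le_mul_of_pos_left _ f.deg_pos) (HasWeight.le hμ f)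
  have hz : ∀ μ ∈ partFuns K n, ∀ f, ¬ f.deg ≤ n → μ f = ⊥ := by
    intro μ hμ f hf
    have h1 : f.deg * (μ f).card ≤ n := HasWeight.le hμ f
    have h2 : (μ f).card = 0 := by
      by_contra h
      exact hf (le_trans (Nat.le_mul_of_pos_right _ (Nat.pos_of_ne_zero h)) h1)
    exact YoungDiagram.ext (Finset.card_eq_zero.mp h2)
  let r : partFuns K n → ({f : Phi K | f.deg ≤ n} → {l : YoungDiagram | l.card ≤ n}) :=
    fun μ f => ⟨μ.1 f.1, hb μ.1 μ.2 f.1⟩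
  have hr : Function.Injective r := by
    intro μ ν h
    refine Subtype.ext (funext fun f => ?_)
    by_cases hf : f.deg ≤ n
    · exact congrArg Subtype.val (congrFun h ⟨f, hf⟩)
    · rw [hz μ.1 μ.2 f hf, hz ν.1 ν.2 f hf]
  exact Finite.of_injective r hr

end GreenGL

/-!
Write `q = |K|`, which is odd. The only contributions to the 2-adic valuation of `d_μ` come from the
factors `q ^ i - 1` and `q ^ (d(f) |h|) - 1`, and `2 ^ j` divides `q ^ a - 1` exactly when the order
`o` of `q` modulo `2 ^ j` divides `a`. Hence the valuation is the sum over `j ≥ 1` of the numbers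
`⌊n / o⌋ - #{(f, h) | o ∣ d(f) |h|}`. Since at most `|λ| / e` hook lengths of a partition `λ` are
divisible by `e`, each of these numbers is nonnegative, and each power of two is the order `o` for
some `j` (`div_two_pow_sub_le_padicValRat`). The valuation of `(n)_k` is less than any `u` with
`n ^ k < 2 ^ u`, so a single large term suffices.

The term with `o = 1` is `n - ∑ f, |μ(f)|`. It depends only on the type `F` and is large unless
almost all the weight of `F` sits on polynomials of degree one. There are boundedly many of those,
so in the remaining case `m = F(f₀)` is proportional to `n` for some `f₀` of degree one
(`exists_deg_one_of_lt_sum`), and the valuation is at least `⌊m / r⌋ - w` for every power `r` of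
two, where `w` is the number of hook lengths of `λ = μ(f₀)` divisible by `r`.

On a beta set of `λ`, removing an `r`-hook slides a bead down by `r`. This lowers `w` by one, the
size by `r`, and the number of displaced beads, which is the side `D` of the Durfee square, by at
most one. What is left after `w` such moves has size at least `(D - w) ^ 2 / 2`, so
`(D - w) ^ 2 ≤ 2 (m - r w)` (`exists_card_eq_hookDvdCount`). With `D` of order `m ^ (2 / 5)` and `r`
of order `m / D` this forces `⌊m / r⌋ - w` to be at least about `m ^ (1 / 10)`, which exceeds any
multiple of `log m` (`exists_add_hookDvdCount_le`). Therefore a bad `μ` has a value `μ(f₀)` with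
small Durfee square. Such partitions are determined by few rows and columns, whereas `m` has at
least `2 ^ (√m - 2)` partitions (`eventually_ncard_smallDurfee_lt`). In a fibre, `μ(f₀)` is
uniformly distributed among the partitions of `m` (`ncard_fiber_mul_le`), which gives the uniform
estimate; summation over all types gives the limit.
-/

/-! ### Bead configurations and the removal of rim hooks -/

namespace GreenGL

open Finset

/-- For a finite set `X` of beads on `ℕ`, the number of pairs of a bead `x ∈ X` and a gap `y ∉ X`
with `y < x` and `r ∣ x - y`. When `X` is a beta set of a partition, these pairs are the hooks whose
length is divisible by `r`. -/
def gapPairs (r : ℕ) (X : Finset ℕ) : ℕ := ∑ x ∈ X, #{y ∈ range x | y ∉ X ∧ r ∣ x - y}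

/-- The number of pairs of beads `y < x` of `X` on the same runner modulo `r`. -/
def beadPairs (r : ℕ) (X : Finset ℕ) : ℕ := ∑ x ∈ X, #{y ∈ range x | y ∈ X ∧ r ∣ x - y}

theorem card_range_filter_dvd_sub (r x : ℕ) : #{y ∈ range x | r ∣ x - y} = x / r := by
  rw [← Nat.Ioc_filter_dvd_card_eq_div x r]
  refine card_nbij' (fun y => x - y) (fun y => x - y) ?_ ?_ ?_ ?_
  · intro y hy
    simp only [coe_filter, mem_range, Set.mem_ofPred_eq, mem_Ioc] at hy ⊢
    exact ⟨by omega, hy.2⟩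
  · intro y hy
    simp only [coe_filter, mem_range, Set.mem_ofPred_eq, mem_Ioc] at hy ⊢
    refine ⟨by omega, ?_⟩
    rw [Nat.sub_sub_self hy.1.2]
    exact hy.2
  · intro y hy
    simp only [coe_filter, mem_range, Set.mem_ofPred_eq] at hy
    exact Nat.sub_sub_self hy.1.le
  · intro y hy
    simp only [coe_filter, mem_Ioc, Set.mem_ofPred_eq] at hy
    exact Nat.sub_sub_self hy.1.2

theorem gapPairs_add_beadPairs (r : ℕ) (X : Finset ℕ) :
    gapPairs r X + beadPairs r X = ∑ x ∈ X, x / r := by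
  rw [gapPairs, beadPairs, ← sum_add_distrib]
  refine sum_congr rfl fun x _ => ?_
  rw [← card_range_filter_dvd_sub r x,
    ← card_filter_add_card_filter_not (s := {y ∈ range x | r ∣ x - y}) (fun y => y ∉ X),
    filter_filter, filter_filter]
  congr 2 <;> (ext y; simp; tauto)

/-- Counting ordered pairs of beads on a common runner: this expresses `beadPairs` through the
residues of the beads only. -/
theorem sum_card_modEq (r : ℕ) (X : Finset ℕ) :
    ∑ x ∈ X, #{y ∈ X | y % r = x % r} = 2 * beadPairs r X + #X := by
  have hlt : ∑ x ∈ X, #{y ∈ X | y < x ∧ y % r = x % r} = beadPairs r X := by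
    refine sum_congr rfl fun x _ => ?_
    congr 1
    ext y
    simp only [mem_filter, mem_range]
    constructor
    · rintro ⟨h1, h2, h3⟩
      exact ⟨h2, h1, (Nat.modEq_iff_dvd' h2.le).mp h3⟩
    · rintro ⟨h2, h1, h3⟩
      exact ⟨h1, h2, (Nat.modEq_iff_dvd' h2.le).mpr h3⟩
  have hgt : ∑ x ∈ X, #{y ∈ X | x < y ∧ y % r = x % r} = beadPairs r X := by
    rw [← hlt]
    have := sum_card_bipartiteAbove_eq_sum_card_bipartiteBelow (s := X) (t := X)
      (fun x y => x < y ∧ y % r = x % r)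
    simp only [bipartiteAbove, bipartiteBelow] at this
    rw [this]
    refine sum_congr rfl fun x _ => ?_
    congr 1
    ext y
    simp only [mem_filter]
    tauto
  have hsplit : ∀ x ∈ X, #{y ∈ X | y % r = x % r} =
      #{y ∈ X | y < x ∧ y % r = x % r} + #{y ∈ X | x < y ∧ y % r = x % r} + 1 := by
    intro x hx
    have h1 : ({y ∈ X | y % r = x % r} : Finset ℕ) =
        insert x ({y ∈ X | y < x ∧ y % r = x % r} ∪ {y ∈ X | x < y ∧ y % r = x % r}) := by
      ext y
      simp only [mem_filter, mem_insert, mem_union]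
      constructor
      · rintro ⟨h1, h2⟩
        rcases lt_trichotomy y x with h | h | h <;> tauto
      · rintro (rfl | h | h)
        · exact ⟨hx, rfl⟩
        · exact ⟨h.1, h.2.2⟩
        · exact ⟨h.1, h.2.2⟩
    rw [h1, card_insert_of_notMem (by simp), card_union_of_disjoint]
    rw [disjoint_filter]
    intro y _ h h'
    omega
  rw [sum_congr rfl hsplit, sum_add_distrib, sum_add_distrib, hlt, hgt, card_eq_sum_ones]
  ring

/-- Moving a bead along its runner does not change the number of pairs of beads on a runner. -/
theorem beadPairs_insert_eq {r x y : ℕ} {Z : Finset ℕ} (hx : x ∉ Z) (hy : y ∉ Z)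
    (hxy : y % r = x % r) : beadPairs r (insert x Z) = beadPairs r (insert y Z) := by
  have h : ∀ a, a ∉ Z → 2 * beadPairs r (insert a Z) + #(insert a Z) =
      1 + #{z ∈ Z | z % r = a % r} + ∑ z ∈ Z, ((if a % r = z % r then 1 else 0) +
        #{y ∈ Z | y % r = z % r}) := by
    intro a ha
    rw [← sum_card_modEq, sum_insert ha, filter_insert, if_pos rfl,
      card_insert_of_notMem (by simp [ha]), add_comm 1]
    congr 1
    refine sum_congr rfl fun z _ => ?_
    rw [filter_insert]
    split_ifs
    · rw [card_insert_of_notMem (by simp [ha]), add_comm]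
    · simp
  have h1 := h x hx
  have h2 := h y hy
  rw [card_insert_of_notMem hx] at h1
  rw [card_insert_of_notMem hy, hxy] at h2
  omega

/-- If some hook length is divisible by `r`, a bead can slide down by exactly `r` into a gap. -/
theorem exists_slide {r : ℕ} {X : Finset ℕ} (h : gapPairs r X ≠ 0) :
    ∃ y, y ∉ X ∧ y + r ∈ X := by
  by_contra! hno
  apply h
  rw [gapPairs, sum_eq_zero]
  intro x hx
  rw [card_eq_zero, filter_eq_empty_iff]
  rintro y hy ⟨hyX, t, ht⟩
  have hyx := mem_range.mp hy
  -- if no bead can slide by `r`, every position above a gap on its runner is a gap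
  have hgap : ∀ t, y + r * t ∉ X := by
    intro t
    induction t with
    | zero => simpa using hyX
    | succ t ih =>
      have := hno _ ih
      rwa [mul_add, mul_one, ← add_assoc]
  apply hgap t
  rwa [← ht, Nat.add_sub_cancel' hyx.le]

theorem sum_range_id_le_sum (X : Finset ℕ) : ∑ i ∈ range #X, i ≤ ∑ x ∈ X, x := by
  induction X using Finset.induction_on_max with
  | empty => simp
  | insert a X h ih =>
    have ha : a ∉ X := fun h' => lt_irrefl _ (h a h')
    have hc : #X ≤ a := by
      have : X ⊆ range a := fun x hx => mem_range.mpr (h x hx)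
      simpa using card_le_card this
    rw [card_insert_of_notMem ha, sum_range_succ, sum_insert ha]
    omega

/-- A bead configuration with `D` beads beyond the first `#X` positions has size at least
`D ^ 2 / 2`, the size being measured from the ground state `range #X`. -/
theorem sq_card_sdiff_range_le (X : Finset ℕ) :
    ∃ e, ∑ x ∈ X, x = ∑ i ∈ range #X, i + e ∧ #(X \ range #X) ^ 2 ≤ 2 * e := by
  set N := #X with hN
  set D := #(X \ range N) with hD
  have hD' : #(range N \ X) = D := by
    have h1 := card_sdiff_add_card_inter X (range N)
    have h2 := card_sdiff_add_card_inter (range N) X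
    rw [inter_comm, card_range] at h2
    omega
  have hS : ∑ x ∈ X, x = ∑ x ∈ X \ range N, x + ∑ x ∈ X ∩ range N, x := by
    rw [add_comm, ← sum_union (disjoint_sdiff_inter X (range N)).symm, union_comm,
      sdiff_union_inter]
  have hR : ∑ x ∈ range N, x = ∑ x ∈ range N \ X, x + ∑ x ∈ X ∩ range N, x := by
    rw [inter_comm, add_comm, ← sum_union (disjoint_sdiff_inter (range N) X).symm, union_comm,
      sdiff_union_inter]
  -- the `D` beads from position `N` on are distinct, while the `D` vacated positions are below `N`
  have hlow : D * N + ∑ i ∈ range D, i ≤ ∑ x ∈ X \ range N, x := by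
    have hinj : Set.InjOn (fun x => x - N) (X \ range N : Finset ℕ) := by
      intro a ha b hb hab
      simp only [coe_sdiff, coe_range, Set.mem_sdiff, mem_coe, Set.mem_Iio, not_lt] at ha hb hab
      omega
    have h1 := sum_range_id_le_sum ((X \ range N).image (fun x => x - N))
    rw [card_image_of_injOn hinj, sum_image hinj] at h1
    have h2 : ∑ x ∈ X \ range N, x = ∑ x ∈ X \ range N, (x - N) + ∑ x ∈ X \ range N, N := by
      rw [← sum_add_distrib]
      refine sum_congr rfl fun x hx => ?_
      simp only [mem_sdiff, mem_range, not_lt] at hx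
      omega
    rw [h2, sum_const, smul_eq_mul, ← hD]
    rw [← hD] at h1
    omega
  have hupp : ∑ x ∈ range N \ X, x + D ≤ D * N := by
    have h1 : ∑ x ∈ range N \ X, (x + 1) ≤ ∑ x ∈ range N \ X, N := by
      refine sum_le_sum fun x hx => ?_
      simp only [mem_sdiff, mem_range] at hx
      omega
    rw [sum_add_distrib, sum_const, sum_const, hD', smul_eq_mul, smul_eq_mul, mul_one] at h1
    exact h1
  have hg := sum_range_id_mul_two D
  refine ⟨∑ x ∈ X, x - ∑ i ∈ range N, i, by omega, ?_⟩
  have hsq : D ^ 2 = D * (D - 1) + D := by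
    cases D with
    | zero => rfl
    | succ d => simp; ring
  have h2 : ∑ i ∈ range D, i + D ≤ ∑ x ∈ X, x - ∑ i ∈ range N, i := by omega
  nlinarith

/-- Removing all `w` removable `r`-hooks one at a time lowers the size by `r * w` and the number of
displaced beads by at most `w`, and what is left is controlled by `sq_card_sdiff_range_le`. -/
theorem sq_card_sdiff_range_sub_gapPairs_le {r : ℕ} (hr : 0 < r) (w : ℕ) (X : Finset ℕ)
    (hw : gapPairs r X = w) :
    ∃ e, ∑ x ∈ X, x = ∑ i ∈ range #X, i + r * w + e ∧ (#(X \ range #X) - w) ^ 2 ≤ 2 * e := by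
  induction w generalizing X with
  | zero => simpa using sq_card_sdiff_range_le X
  | succ w ih =>
    obtain ⟨y, hyX, hyr⟩ := exists_slide (r := r) (X := X) (by omega)
    set Z := X.erase (y + r) with hZ
    have hxZ : y + r ∉ Z := notMem_erase _ _
    have hyZ : y ∉ Z := fun h => hyX (mem_of_mem_erase h)
    have hX : X = insert (y + r) Z := (insert_erase hyr).symm
    have hcard : #(insert y Z) = #X := by
      rw [hX, card_insert_of_notMem hyZ, card_insert_of_notMem hxZ]
    have hsum : ∑ x ∈ X, x = ∑ x ∈ insert y Z, x + r := by
      rw [hX, sum_insert hyZ, sum_insert hxZ]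
      ring
    have hw' : gapPairs r (insert y Z) = w := by
      have h1 := gapPairs_add_beadPairs r X
      have h2 := gapPairs_add_beadPairs r (insert y Z)
      have h3 := beadPairs_insert_eq (r := r) hxZ hyZ (by simp)
      rw [hX, sum_insert hxZ, Nat.add_div_right _ hr] at h1
      rw [sum_insert hyZ] at h2
      rw [hX] at hw
      omega
    obtain ⟨e, he1, he2⟩ := ih (insert y Z) hw'
    rw [hcard] at he1 he2
    refine ⟨e, by rw [hsum, he1]; ring, le_trans (Nat.pow_le_pow_left ?_ 2) he2⟩
    have hsub : X \ range #X ⊆ insert (y + r) (insert y Z \ range #X) := by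
      intro z hz
      rw [mem_sdiff] at hz
      by_cases hzx : z = y + r
      · exact hzx ▸ mem_insert_self _ _
      · exact mem_insert_of_mem (mem_sdiff.mpr
          ⟨mem_insert_of_mem (mem_erase.mpr ⟨hzx, hz.1⟩), hz.2⟩)
    have := (card_le_card hsub).trans (card_insert_le _ _)
    omega

end GreenGL

/-! ### Hook lengths and beta sets of Young diagrams -/

namespace GreenGL

open Finset

/-- The number of cells of `l` whose hook length is divisible by `r`. -/
def hookDvdCount (r : ℕ) (l : YoungDiagram) : ℕ := #{c ∈ l.cells | r ∣ hookLength l c}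

/-- The first-column hook length of row `i`, when the diagram is regarded as having `N` rows, some
of them possibly empty. -/
def bead (N : ℕ) (l : YoungDiagram) (i : ℕ) : ℕ := l.rowLen i + (N - 1 - i)

/-- The beta set of `l` regarded as having `N` rows. -/
def betaSet (N : ℕ) (l : YoungDiagram) : Finset ℕ := (range N).image (bead N l)

theorem bead_lt_bead {N : ℕ} (l : YoungDiagram) {i i' : ℕ} (h : i < i') (h' : i' < N) :
    bead N l i' < bead N l i := by
  have := l.rowLen_anti i i' h.le
  simp only [bead]
  omega

theorem injOn_bead (N : ℕ) (l : YoungDiagram) : Set.InjOn (bead N l) (range N) := by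
  intro i hi i' hi' h
  simp only [coe_range, Set.mem_Iio] at hi hi'
  rcases lt_trichotomy i i' with h1 | h1 | h1
  · have := bead_lt_bead l h1 hi'
    omega
  · exact h1
  · have := bead_lt_bead l h1 hi
    omega

theorem card_betaSet (N : ℕ) (l : YoungDiagram) : #(betaSet N l) = N := by
  rw [betaSet, card_image_of_injOn (injOn_bead N l), card_range]

theorem colLen_zero_le_card (l : YoungDiagram) : l.colLen 0 ≤ l.card := by
  rw [l.colLen_eq_card]
  exact card_le_card (filter_subset _ _)

theorem rowLen_zero_le_card (l : YoungDiagram) : l.rowLen 0 ≤ l.card := by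
  rw [l.rowLen_eq_card]
  exact card_le_card (filter_subset _ _)

theorem card_filter_cells (l : YoungDiagram) {N : ℕ} (hN : l.colLen 0 ≤ N) (p : ℕ × ℕ → Prop)
    [DecidablePred p] :
    #{c ∈ l.cells | p c} = ∑ i ∈ range N, #{j ∈ range (l.rowLen i) | p (i, j)} := by
  rw [card_eq_sum_card_fiberwise (f := Prod.fst) (t := range N)]
  · refine sum_congr rfl fun i _ => ?_
    symm
    refine card_bij (fun j _ => (i, j)) ?_ ?_ ?_
    · intro j hj
      simp only [mem_filter, mem_range] at hj ⊢
      exact ⟨⟨YoungDiagram.mem_iff_lt_rowLen.mpr hj.1, hj.2⟩, trivial⟩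
    · intro j _ j' _ h
      exact (Prod.ext_iff.mp h).2
    · rintro ⟨i', j⟩ h
      simp only [mem_filter] at h
      obtain ⟨⟨h1, h2⟩, rfl⟩ := h
      refine ⟨j, ?_, rfl⟩
      simp only [mem_filter, mem_range]
      exact ⟨YoungDiagram.mem_iff_lt_rowLen.mp h1, h2⟩
  · rintro ⟨i, j⟩ h
    simp only [coe_filter, Set.mem_ofPred_eq] at h
    have h1 := YoungDiagram.mem_iff_lt_colLen.mp ((YoungDiagram.mem_cells _).mp h.1)
    have := l.colLen_anti 0 j (Nat.zero_le _)
    simp only [coe_range, Set.mem_Iio]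
    omega

theorem card_eq_sum_rowLen (l : YoungDiagram) {N : ℕ} (hN : l.colLen 0 ≤ N) :
    l.card = ∑ i ∈ range N, l.rowLen i := by
  have := card_filter_cells l hN (fun _ => True)
  simpa using this

theorem sum_betaSet {l : YoungDiagram} {N : ℕ} (hN : l.colLen 0 ≤ N) :
    ∑ x ∈ betaSet N l, x = ∑ i ∈ range N, i + l.card := by
  rw [betaSet, sum_image (injOn_bead N l), card_eq_sum_rowLen l hN,
    ← sum_range_reflect (fun i => i), ← sum_add_distrib]
  exact sum_congr rfl fun i _ => add_comm _ _

/-- Column `j` of `l` gives the position `N + j - colLen j`. If `(i, j)` is a cell, this position is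
below the bead of row `i`, at a distance equal to the hook length; otherwise it is above that bead
(`bead_lt_gap`). In particular it is a gap of the beta set. -/
theorem gap_lt_bead {l : YoungDiagram} {N i j : ℕ} (hN : l.colLen 0 ≤ N) (hi : i < N)
    (h : (i, j) ∈ l) : N + j - l.colLen j < bead N l i ∧
      bead N l i - (N + j - l.colLen j) = hookLength l (i, j) := by
  have h1 := YoungDiagram.mem_iff_lt_rowLen.mp h
  have h2 := YoungDiagram.mem_iff_lt_colLen.mp h
  have h3 := l.colLen_anti 0 j (Nat.zero_le _)
  simp only [bead, hookLength]
  omega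

theorem bead_lt_gap {l : YoungDiagram} {N i j : ℕ} (hi : i < N)
    (h : (i, j) ∉ l) : bead N l i < N + j - l.colLen j := by
  rw [YoungDiagram.mem_iff_lt_rowLen] at h
  have h2 : ¬ i < l.colLen j := by
    rwa [← YoungDiagram.mem_iff_lt_colLen, YoungDiagram.mem_iff_lt_rowLen]
  simp only [bead]
  omega

theorem gap_notMem_betaSet {l : YoungDiagram} {N : ℕ} (hN : l.colLen 0 ≤ N) (j : ℕ) :
    N + j - l.colLen j ∉ betaSet N l := by
  rw [betaSet, mem_image]
  rintro ⟨i, hi, h⟩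
  by_cases hij : (i, j) ∈ l
  · have := (gap_lt_bead hN (mem_range.mp hi) hij).1
    omega
  · have := bead_lt_gap (mem_range.mp hi) hij
    omega

theorem injective_gap {l : YoungDiagram} {N : ℕ} (hN : l.colLen 0 ≤ N) :
    Function.Injective fun j => N + j - l.colLen j := by
  refine StrictMono.injective fun j j' h => ?_
  have h1 := l.colLen_anti j j' h.le
  have h2 := l.colLen_anti 0 j (Nat.zero_le _)
  omega

/-- The gaps below the bead of row `i` are those given by the columns meeting row `i`. Inclusion is
clear, and the two sides have the same cardinality because exactly `N - 1 - i` beads lie below. -/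
theorem range_bead_sdiff_betaSet {l : YoungDiagram} {N i : ℕ} (hN : l.colLen 0 ≤ N) (hi : i < N) :
    range (bead N l i) \ betaSet N l =
      (range (l.rowLen i)).image fun j => N + j - l.colLen j := by
  symm
  apply eq_of_subset_of_card_le
  · intro y hy
    obtain ⟨j, hj, rfl⟩ := mem_image.mp hy
    rw [mem_sdiff, mem_range]
    exact ⟨(gap_lt_bead hN hi (YoungDiagram.mem_iff_lt_rowLen.mpr (mem_range.mp hj))).1,
      gap_notMem_betaSet hN j⟩
  · rw [card_image_of_injective _ (injective_gap hN), card_range, card_sdiff, card_range]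
    have h1 : (Ioo i N).image (bead N l) ⊆ betaSet N l ∩ range (bead N l i) := by
      intro x hx
      obtain ⟨i', hi', rfl⟩ := mem_image.mp hx
      rw [mem_Ioo] at hi'
      exact mem_inter.mpr ⟨mem_image_of_mem _ (mem_range.mpr hi'.2),
        mem_range.mpr (bead_lt_bead l hi'.1 hi'.2)⟩
    have h2 := card_le_card h1
    rw [card_image_of_injOn ((injOn_bead N l).mono fun x hx => by
      simp only [coe_Ioo, Set.mem_Ioo, coe_range, Set.mem_Iio] at hx ⊢; exact hx.2),
      Nat.card_Ioo] at h2
    simp only [bead] at h2 ⊢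
    omega

theorem gapPairs_betaSet (r : ℕ) {l : YoungDiagram} {N : ℕ} (hN : l.colLen 0 ≤ N) :
    gapPairs r (betaSet N l) = hookDvdCount r l := by
  rw [hookDvdCount, card_filter_cells l hN, gapPairs]
  conv_lhs => rw [betaSet]
  rw [sum_image (injOn_bead N l)]
  refine sum_congr rfl fun i hi => ?_
  have hi' := mem_range.mp hi
  have h1 : ({y ∈ range (bead N l i) | y ∉ betaSet N l ∧ r ∣ bead N l i - y} : Finset ℕ) =
      {y ∈ range (bead N l i) \ betaSet N l | r ∣ bead N l i - y} := by
    ext y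
    simp only [mem_filter, mem_sdiff]
    tauto
  change #{y ∈ range (bead N l i) | y ∉ betaSet N l ∧ r ∣ bead N l i - y} = _
  rw [h1, range_bead_sdiff_betaSet hN hi', filter_image,
    card_image_of_injective _ (injective_gap hN)]
  congr 1
  refine filter_congr fun j hj => ?_
  rw [(gap_lt_bead hN hi' (YoungDiagram.mem_iff_lt_rowLen.mpr (mem_range.mp hj))).2]

/-- If the hook lengths divisible by `r` are `w` in number, and the Durfee square of `l` has side
larger than `d`, then `|l| - r * w` is at least about `(d + 1 - w) ^ 2 / 2`. -/
theorem exists_card_eq_hookDvdCount {r : ℕ} (hr : 0 < r) (l : YoungDiagram) :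
    ∃ e, l.card = r * hookDvdCount r l + e ∧
      ∀ d, (d, d) ∈ l → (d + 1 - hookDvdCount r l) ^ 2 ≤ 2 * e := by
  have hN := colLen_zero_le_card l
  obtain ⟨e, he1, he2⟩ :=
    sq_card_sdiff_range_sub_gapPairs_le hr _ (betaSet l.card l) (gapPairs_betaSet r hN)
  rw [sum_betaSet hN, card_betaSet] at he1
  rw [card_betaSet] at he2
  refine ⟨e, by omega, fun d hd => le_trans (Nat.pow_le_pow_left ?_ 2) he2⟩
  have h1 := YoungDiagram.mem_iff_lt_rowLen.mp hd
  have h2 := YoungDiagram.mem_iff_lt_colLen.mp hd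
  have h3 := l.colLen_anti 0 d (Nat.zero_le _)
  have hsub : (range (d + 1)).image (bead l.card l) ⊆
      betaSet l.card l \ range l.card := by
    intro x hx
    obtain ⟨i, hi, rfl⟩ := mem_image.mp hx
    rw [mem_range] at hi
    have := l.rowLen_anti i d (by omega)
    rw [mem_sdiff, mem_range]
    refine ⟨mem_image_of_mem _ (mem_range.mpr (by omega)), ?_⟩
    simp only [bead]
    omega
  have h4 := card_le_card hsub
  rw [card_image_of_injOn ((injOn_bead _ l).mono fun x hx => by
    simp only [coe_range, Set.mem_Iio] at hx ⊢; omega), card_range] at h4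
  omega

theorem mul_hookDvdCount_le {r : ℕ} (hr : 0 < r) (l : YoungDiagram) :
    r * hookDvdCount r l ≤ l.card := by
  obtain ⟨e, he, -⟩ := exists_card_eq_hookDvdCount hr l
  omega

theorem hookLength_pos (l : YoungDiagram) (c : ℕ × ℕ) : 0 < hookLength l c := Nat.succ_pos _

theorem hookLength_le_card {l : YoungDiagram} {c : ℕ × ℕ} (hc : c ∈ l.cells) :
    hookLength l c ≤ l.card := by
  refine le_trans (Nat.le_mul_of_pos_right _ ?_) (mul_hookDvdCount_le (hookLength_pos l c) l)
  exact card_pos.mpr ⟨c, mem_filter.mpr ⟨hc, dvd_rfl⟩⟩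

end GreenGL

/-! ### Counting partitions with a small Durfee square -/

namespace GreenGL

open Finset Filter

/-- The partitions of `m`. -/
def partitionsOf (m : ℕ) : Set YoungDiagram := {l | l.card = m}

/-- The partitions of `m` whose Durfee square has side at most `d`. -/
def smallDurfee (m d : ℕ) : Set YoungDiagram := {l | l.card = m ∧ (d, d) ∉ l}

theorem finite_partitionsOf (m : ℕ) : (partitionsOf m).Finite :=
  (finite_card_le m).subset fun _ h => le_of_eq h

/-- A partition whose Durfee square has side at most `d` is determined by its first `d` rows and
its first `d` columns. -/
theorem ncard_smallDurfee_le (m d : ℕ) : (smallDurfee m d).ncard ≤ (m + 1) ^ (2 * d) := by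
  have hrow : ∀ l ∈ smallDurfee m d, ∀ i, l.rowLen i < m + 1 := fun l hl i => by
    have := (l.rowLen_anti 0 i (Nat.zero_le _)).trans (rowLen_zero_le_card l)
    have := hl.1
    omega
  have hcol : ∀ l ∈ smallDurfee m d, ∀ i, l.colLen i < m + 1 := fun l hl i => by
    have := (l.colLen_anti 0 i (Nat.zero_le _)).trans (colLen_zero_le_card l)
    have := hl.1
    omega
  let φ : smallDurfee m d → (Fin d → Fin (m + 1)) × (Fin d → Fin (m + 1)) := fun l =>
    (fun i => ⟨l.1.rowLen i, hrow l.1 l.2 i⟩, fun j => ⟨l.1.colLen j, hcol l.1 l.2 j⟩)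
  have hφ : Function.Injective φ := by
    intro l l' h
    obtain ⟨h1, h2⟩ := Prod.ext_iff.mp h
    have hr : ∀ i < d, l.1.rowLen i = l'.1.rowLen i := fun i hi =>
      congrArg Fin.val (congrFun h1 ⟨i, hi⟩)
    have hc : ∀ i < d, l.1.colLen i = l'.1.colLen i := fun i hi =>
      congrArg Fin.val (congrFun h2 ⟨i, hi⟩)
    refine Subtype.ext (YoungDiagram.ext (Finset.ext ?_))
    rintro ⟨i, j⟩
    rw [YoungDiagram.mem_cells, YoungDiagram.mem_cells]
    rcases lt_or_ge i d with hi | hi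
    · rw [YoungDiagram.mem_iff_lt_rowLen, YoungDiagram.mem_iff_lt_rowLen, hr i hi]
    rcases lt_or_ge j d with hj | hj
    · rw [YoungDiagram.mem_iff_lt_colLen, YoungDiagram.mem_iff_lt_colLen, hc j hj]
    · exact iff_of_false (fun h => l.2.2 (l.1.up_left_mem hi hj h))
        (fun h => l'.2.2 (l'.1.up_left_mem hi hj h))
  have := Nat.card_le_card_of_injective φ hφ
  rw [Nat.card_coe_set_eq] at this
  refine this.trans (le_of_eq ?_)
  simp only [Nat.card_eq_fintype_card, Fintype.card_prod, Fintype.card_pi, Fintype.card_fin,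
    prod_const, card_univ]
  rw [two_mul, pow_add]

/-- The row lengths of a partition of `m` consisting of a staircase with `t` rows, an extra cell in
the rows of the staircase indexed by `S`, and a long row on top. -/
def stairRows (m t : ℕ) (S : Finset ℕ) : ℕ → ℕ
  | 0 => m - ∑ i ∈ range t, ((t - i) + if i ∈ S then 1 else 0)
  | i + 1 => if i < t then (t - i) + if i ∈ S then 1 else 0 else 0

theorem sum_stair_le (t : ℕ) (S : Finset ℕ) :
    ∑ i ∈ range t, ((t - i) + if i ∈ S then 1 else 0) ≤ t * (t + 1) := by
  have : ∑ i ∈ range t, ((t - i) + if i ∈ S then 1 else 0) ≤ ∑ i ∈ range t, (t + 1) := by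
    refine sum_le_sum fun i _ => ?_
    split_ifs <;> omega
  simpa using this

theorem stairRows_antitone {m t : ℕ} (h : (t + 1) ^ 2 ≤ m) (S : Finset ℕ) :
    Antitone (stairRows m t S) := by
  refine antitone_nat_of_succ_le fun i => ?_
  cases i with
  | zero =>
    have := sum_stair_le t S
    have h2 : (t + 1) ^ 2 = t * (t + 1) + (t + 1) := by ring
    simp only [stairRows]
    split_ifs <;> omega
  | succ i =>
    simp only [stairRows]
    split_ifs <;> omega

/-- The partition of `m` with row lengths `stairRows m t S`. -/
def stair {m t : ℕ} (h : (t + 1) ^ 2 ≤ m) (S : Finset ℕ) : YoungDiagram where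
  cells := {c ∈ range (t + 1) ×ˢ range (m + 1) | c.2 < stairRows m t S c.1}
  isLowerSet := by
    rintro ⟨i, j⟩ ⟨i', j'⟩ ⟨hi, hj⟩ hc
    simp only [coe_filter, mem_product, mem_range, Set.mem_ofPred_eq] at hc hi hj ⊢
    have := stairRows_antitone h S hi
    omega

theorem mem_stair {m t : ℕ} (h : (t + 1) ^ 2 ≤ m) (S : Finset ℕ) (i j : ℕ) :
    (i, j) ∈ stair h S ↔ j < stairRows m t S i := by
  rw [← YoungDiagram.mem_cells]
  simp only [stair, mem_filter, mem_product, mem_range, and_iff_right_iff_imp]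
  intro hj
  have h1 := stairRows_antitone h S (Nat.zero_le i)
  have h2 : stairRows m t S 0 ≤ m := by
    simp only [stairRows]
    omega
  refine ⟨?_, by omega⟩
  by_contra hi
  obtain ⟨i, rfl⟩ : ∃ i', i = i' + 1 := ⟨i - 1, by omega⟩
  simp only [stairRows] at hj
  split_ifs at hj <;> omega

theorem stair_mem_partitionsOf {m t : ℕ} (h : (t + 1) ^ 2 ≤ m) (S : Finset ℕ) :
    stair h S ∈ partitionsOf m := by
  have hrow : ∀ i, (stair h S).rowLen i = stairRows m t S i := fun i => by
    apply Nat.le_antisymm <;> by_contra! hlt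
    · have := (mem_stair h S i _).mp (YoungDiagram.mem_iff_lt_rowLen.mpr hlt)
      omega
    · have := YoungDiagram.mem_iff_lt_rowLen.mp ((mem_stair h S i _).mpr hlt)
      omega
  have hcol : (stair h S).colLen 0 ≤ t + 1 := by
    by_contra! hlt
    have := (mem_stair h S _ _).mp (YoungDiagram.mem_iff_lt_colLen.mpr hlt)
    simp [stairRows] at this
  have h1 := sum_stair_le t S
  have h2 : (t + 1) ^ 2 = t * (t + 1) + (t + 1) := by ring
  change (stair h S).card = m
  rw [card_eq_sum_rowLen _ hcol, sum_congr rfl fun i _ => hrow i, sum_range_succ']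
  have h3 : ∑ i ∈ range t, stairRows m t S (i + 1) =
      ∑ i ∈ range t, ((t - i) + if i ∈ S then 1 else 0) := by
    refine sum_congr rfl fun i hi => ?_
    simp only [stairRows, if_pos (mem_range.mp hi)]
  rw [h3]
  simp only [stairRows]
  omega

theorem two_pow_le_ncard_partitionsOf {m t : ℕ} (h : (t + 1) ^ 2 ≤ m) :
    2 ^ t ≤ (partitionsOf m).ncard := by
  have h1 : ((range t).powerset : Set (Finset ℕ)).ncard = 2 ^ t := by
    rw [Set.ncard_coe_finset, card_powerset, card_range]
  rw [← h1]
  refine Set.ncard_le_ncard_of_injOn (fun S => stair h S)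
    (fun S _ => stair_mem_partitionsOf h S) ?_ (finite_partitionsOf m)
  intro S hS S' hS' hSS'
  rw [mem_coe, mem_powerset] at hS hS'
  -- `i ∈ S` can be read off from the presence of the cell just outside row `i` of the staircase
  have key : ∀ S : Finset ℕ, ∀ i < t, i ∈ S ↔ (i + 1, t - i) ∈ stair h S := by
    intro S i hi
    rw [mem_stair, stairRows, if_pos hi]
    split_ifs with hiS <;> simp [hiS]
  have hSS'' : stair h S = stair h S' := hSS'
  ext i
  by_cases hi : i < t
  · rw [key S i hi, key S' i hi, hSS'']
  · exact iff_of_false (fun h => hi (mem_range.mp (hS h))) (fun h => hi (mem_range.mp (hS' h)))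

/-- A polynomial in `t` is eventually smaller than `2 ^ t`. -/
theorem eventually_mul_pow_lt_two_pow (c a : ℕ) : ∀ᶠ t : ℕ in atTop, c * (t + 1) ^ a < 2 ^ t := by
  have h := tendsto_pow_const_div_const_pow_of_one_lt a (one_lt_two : (1 : ℝ) < 2)
  have h' := (tendsto_add_atTop_iff_nat 1).mpr h
  have hpos : (0 : ℝ) < 1 / (2 * (c + 1)) := by positivity
  filter_upwards [h'.eventually_lt_const hpos] with t ht
  rw [div_lt_div_iff₀ (by positivity) (by positivity), pow_succ] at ht
  have h2 : (0 : ℝ) ≤ ((t : ℝ) + 1) ^ a := by positivity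
  push_cast at ht
  have : (c : ℝ) * (t + 1) ^ a < 2 ^ t := by nlinarith
  exact_mod_cast this

/-- Partitions of `m` with Durfee square of side less than about `m ^ (2 / 5)` are rare: there are
`exp (O (m ^ (2 / 5) * log m))` of them, among at least `exp (c * m ^ (1 / 2))`. Writing `t` for the
integral part of `m ^ (1 / 10)` keeps the exponents integral: the side is `t ^ 4`, and the total
number is at least `2 ^ (t ^ 5 - 1)`. -/
theorem eventually_ncard_smallDurfee_lt {ε : ℝ} (hε : 0 < ε) :
    ∀ᶠ t : ℕ in atTop, ∀ m, t ^ 10 ≤ m → m < (t + 1) ^ 10 →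
      ((smallDurfee m (t ^ 4 - 1)).ncard : ℝ) < ε * (partitionsOf m).ncard := by
  obtain ⟨M, hM⟩ := exists_nat_gt (2 / ε)
  filter_upwards [eventually_mul_pow_lt_two_pow 2 20, eventually_ge_atTop (M + 1)]
    with t ht hMt m h1 h2
  have hup : (smallDurfee m (t ^ 4 - 1)).ncard ≤ ((t + 1) ^ 20) ^ (t ^ 4) := by
    refine (ncard_smallDurfee_le m _).trans ?_
    rw [← pow_mul]
    calc (m + 1) ^ (2 * (t ^ 4 - 1)) ≤ ((t + 1) ^ 10) ^ (2 * (t ^ 4 - 1)) :=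
          Nat.pow_le_pow_left h2 _
      _ = (t + 1) ^ (20 * (t ^ 4 - 1)) := by rw [← pow_mul]; ring_nf
      _ ≤ _ := Nat.pow_le_pow_right (Nat.succ_pos t) (Nat.mul_le_mul_left _ (Nat.sub_le _ _))
  have hlow : 2 ^ (t ^ 5) ≤ 2 * (partitionsOf m).ncard := by
    have ht5 : 1 ≤ t ^ 5 := Nat.one_le_pow _ _ (by omega)
    have := two_pow_le_ncard_partitionsOf (m := m) (t := t ^ 5 - 1) (by
      rw [Nat.sub_add_cancel ht5, ← pow_mul]
      exact h1)
    calc 2 ^ (t ^ 5) = 2 * 2 ^ (t ^ 5 - 1) := by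
          rw [← pow_succ', Nat.sub_add_cancel ht5]
      _ ≤ _ := Nat.mul_le_mul_left _ this
  have hmid : 2 ^ (t ^ 4) * ((t + 1) ^ 20) ^ (t ^ 4) ≤ 2 ^ (t ^ 5) := by
    rw [← mul_pow, pow_succ t 4, mul_comm (t ^ 4) t, pow_mul 2]
    exact Nat.pow_le_pow_left ht.le _
  have hM4 : M < 2 ^ (t ^ 4) := by
    have h3 : t ≤ t ^ 4 := Nat.le_self_pow (by norm_num) t
    have h4 : t ^ 4 < 2 ^ (t ^ 4) := Nat.lt_two_pow_self
    omega
  have hall : M * (smallDurfee m (t ^ 4 - 1)).ncard ≤ 2 * (partitionsOf m).ncard :=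
    calc M * (smallDurfee m (t ^ 4 - 1)).ncard
        ≤ 2 ^ (t ^ 4) * ((t + 1) ^ 20) ^ (t ^ 4) := Nat.mul_le_mul hM4.le hup
      _ ≤ _ := hmid.trans hlow
  have hallR : (M : ℝ) * (smallDurfee m (t ^ 4 - 1)).ncard ≤ 2 * (partitionsOf m).ncard := by
    exact_mod_cast hall
  have hp : (0 : ℝ) < (partitionsOf m).ncard := by
    have : 0 < (partitionsOf m).ncard := by
      have := Nat.two_pow_pos (t ^ 5)
      omega
    exact_mod_cast this
  rw [div_lt_iff₀ hε] at hM
  have hM0 : (0 : ℝ) < M := by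
    by_contra! hneg
    nlinarith
  have : (M : ℝ) * (smallDurfee m (t ^ 4 - 1)).ncard < M * (ε * (partitionsOf m).ncard) := by
    nlinarith
  exact lt_of_mul_lt_mul_left this hM0.le

/-- For a partition with a large Durfee square there is a power `2 ^ i` which divides far fewer
hook lengths than it divides integers in `[1, m]`. The power is chosen of order `2 * m / t ^ 4`, so
that at most `t ^ 4 / 2` hook lengths are divisible by it, and removing the corresponding hooks
leaves half of the side of the Durfee square. The bound `32768 = 32 * 2 ^ 10` absorbs the constants,
with `2 ^ 10` coming from `(t + 1) ^ 10 ≤ (2 * t) ^ 10`. -/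
theorem exists_add_hookDvdCount_le {m t : ℕ} (ht : 32768 ≤ t) (h1 : t ^ 10 ≤ m)
    (h2 : m < (t + 1) ^ 10) {l : YoungDiagram} (hl : l.card = m)
    (hd : (t ^ 4 - 1, t ^ 4 - 1) ∈ l) : ∃ i, t + hookDvdCount (2 ^ i) l ≤ m / 2 ^ i := by
  have ht4 : 0 < t ^ 4 := Nat.pow_pos (by omega)
  have hex : ∃ i, 2 * m ≤ 2 ^ i * t ^ 4 :=
    ⟨2 * m, (Nat.lt_two_pow_self).le.trans (Nat.le_mul_of_pos_right _ ht4)⟩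
  classical
  set i := Nat.find hex with hi
  have hi1 : 2 * m ≤ 2 ^ i * t ^ 4 := Nat.find_spec hex
  have hi2 : 2 ^ i * t ^ 4 ≤ 4 * m := by
    rcases Nat.eq_zero_or_pos i with h0 | hpos
    · rw [h0, pow_zero, one_mul]
      have : t ^ 4 ≤ t ^ 10 := Nat.pow_le_pow_right (by omega) (by norm_num)
      omega
    · have := Nat.find_min hex (m := i - 1) (by omega)
      rw [← Nat.sub_add_cancel hpos, pow_succ]
      rw [not_le] at this
      linarith
  refine ⟨i, ?_⟩
  obtain ⟨e, he, hdur⟩ := exists_card_eq_hookDvdCount (Nat.two_pow_pos i) l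
  have hsq := hdur _ hd
  rw [Nat.sub_add_cancel ht4] at hsq
  set w := hookDvdCount (2 ^ i) l
  set r := 2 ^ i with hr
  have hrpos : 0 < r := Nat.two_pow_pos i
  have hw : 2 * w ≤ t ^ 4 := by
    have : r * (2 * w) ≤ r * t ^ 4 := by nlinarith
    exact Nat.le_of_mul_le_mul_left this hrpos
  have he8 : t ^ 8 ≤ 8 * e := by
    have h3 : t ^ 4 ≤ 2 * (t ^ 4 - w) := by omega
    have h4 := Nat.pow_le_pow_left h3 2
    have h5 : (t ^ 4) ^ 2 = t ^ 8 := by ring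
    rw [h5, mul_pow] at h4
    omega
  have hm : 8 * (4 * m * t) ≤ t ^ 12 := by
    have h3 : (t + 1) ^ 10 ≤ (2 * t) ^ 10 := Nat.pow_le_pow_left (by omega) 10
    have h4 : (2 * t) ^ 10 = 1024 * t ^ 10 := by ring
    have h5 : t ^ 12 = t ^ 10 * t * t := by ring
    calc 8 * (4 * m * t) ≤ 8 * (4 * (1024 * t ^ 10) * t) := by gcongr; omega
      _ = t ^ 10 * t * 32768 := by ring
      _ ≤ t ^ 10 * t * t := Nat.mul_le_mul_left _ ht
      _ = t ^ 12 := by ring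
  have hre : t * r ≤ e := by
    have h3 : t ^ 4 * (8 * (t * r)) ≤ t ^ 4 * (8 * e) :=
      calc t ^ 4 * (8 * (t * r)) = 8 * ((r * t ^ 4) * t) := by ring
        _ ≤ 8 * (4 * m * t) := by gcongr
        _ ≤ t ^ 12 := hm
        _ = t ^ 4 * t ^ 8 := by ring
        _ ≤ _ := Nat.mul_le_mul_left _ he8
    have := Nat.le_of_mul_le_mul_left h3 ht4
    omega
  rw [Nat.le_div_iff_mul_le hrpos, ← hl, he]
  nlinarith

end GreenGL

/-! ### The 2-adic valuation of Green's degree expression -/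

namespace GreenGL

open Finset

theorem two_pow_dvd_pow_sub_one_iff {q : ℕ} (hq : 0 < q) (j i : ℕ) :
    2 ^ j ∣ q ^ i - 1 ↔ orderOf (q : ZMod (2 ^ j)) ∣ i := by
  rw [orderOf_dvd_iff_pow_eq_one, ← ZMod.natCast_eq_zero_iff,
    Nat.cast_sub (Nat.one_le_pow _ _ hq), sub_eq_zero, Nat.cast_pow, Nat.cast_one]

theorem orderOf_two_pow_pos {q : ℕ} (hq : Odd q) (j : ℕ) : 0 < orderOf (q : ZMod (2 ^ j)) := by
  have hcop : q.Coprime (2 ^ j) := (Nat.coprime_two_right.mpr hq).pow_right j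
  rw [orderOf_pos_iff, isOfFinOrder_iff_pow_eq_one]
  refine ⟨Nat.totient (2 ^ j), Nat.totient_pos.mpr (Nat.two_pow_pos j), ?_⟩
  have := (ZMod.natCast_eq_natCast_iff _ _ _).mpr (Nat.ModEq.pow_totient hcop)
  simpa using this

/-- Every power of two is the order of `q` modulo some power of two: modulo the exact power of two
dividing `q ^ 2 ^ i - 1` the order is `2 ^ i`, since `q ^ 2 ^ i - 1` is divisible by
`2 * (q ^ 2 ^ (i - 1) - 1)`. -/
theorem exists_orderOf_eq_two_pow {q : ℕ} (hq : Odd q) (hq1 : 1 < q) (i : ℕ) :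
    ∃ j, 1 ≤ j ∧ orderOf (q : ZMod (2 ^ j)) = 2 ^ i := by
  have hne : q ^ 2 ^ i - 1 ≠ 0 := by
    have := Nat.one_lt_pow (Nat.two_pow_pos i).ne' hq1
    omega
  refine ⟨padicValNat 2 (q ^ 2 ^ i - 1), ?_, ?_⟩
  · refine one_le_padicValNat_of_dvd hne (Even.two_dvd ?_)
    exact Nat.Odd.sub_odd hq.pow odd_one
  · set j := padicValNat 2 (q ^ 2 ^ i - 1) with hj
    have h1 : orderOf (q : ZMod (2 ^ j)) ∣ 2 ^ i :=
      (two_pow_dvd_pow_sub_one_iff hq.pos j _).mp pow_padicValNat_dvd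
    obtain ⟨i', hi', hord⟩ := (Nat.dvd_prime_pow Nat.prime_two).mp h1
    rw [hord]
    by_contra hlt
    have hlt' : i' < i := lt_of_le_of_ne hi' fun h => hlt (by rw [h])
    have h2 : 2 ^ j ∣ q ^ 2 ^ (i - 1) - 1 := by
      rw [two_pow_dvd_pow_sub_one_iff hq.pos, hord]
      exact pow_dvd_pow 2 (by omega)
    have h3 : q ^ 2 ^ i - 1 = (q ^ 2 ^ (i - 1) + 1) * (q ^ 2 ^ (i - 1) - 1) := by
      rw [← Nat.sq_sub_sq _ 1, one_pow, ← pow_mul, ← pow_succ, Nat.sub_add_cancel (by omega)]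
    have h4 : 2 ∣ q ^ 2 ^ (i - 1) + 1 := (Odd.add_odd hq.pow odd_one).two_dvd
    apply pow_succ_padicValNat_not_dvd (p := 2) hne
    rw [← hj, h3, pow_succ']
    exact mul_dvd_mul h4 h2

theorem padicValRat_pow_sub_one {q a J : ℕ} (hq1 : 1 < q) (ha : 0 < a) (hJ : q ^ a ≤ 2 ^ J) :
    padicValRat 2 ((q : ℚ) ^ a - 1) =
      (#{j ∈ Icc 1 J | orderOf (q : ZMod (2 ^ j)) ∣ a} : ℤ) := by
  have h1 := Nat.one_lt_pow ha.ne' hq1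
  have hcast : (q : ℚ) ^ a - 1 = ((q ^ a - 1 : ℕ) : ℚ) := by
    rw [Nat.cast_sub h1.le]
    push_cast
    rfl
  rw [hcast, padicValRat.of_nat, ← Nat.factorization_def _ Nat.prime_two,
    Nat.factorization_eq_card_pow_dvd _ Nat.prime_two,
    Nat.Ico_filter_pow_dvd_eq Nat.prime_two (by omega) (by omega : q ^ a - 1 ≤ 2 ^ J)]
  simp only [two_pow_dvd_pow_sub_one_iff (zero_lt_one.trans hq1)]

theorem padicValRat_prod {ι : Type*} (S : Finset ι) (g : ι → ℚ) (hg : ∀ i ∈ S, g i ≠ 0) :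
    padicValRat 2 (∏ i ∈ S, g i) = ∑ i ∈ S, padicValRat 2 (g i) := by
  classical
  induction S using Finset.induction_on with
  | empty => simp
  | insert a S ha ih =>
    rw [prod_insert ha, sum_insert ha, padicValRat.mul (hg a (mem_insert_self _ _))
      (prod_ne_zero_iff.mpr fun i hi => hg i (mem_insert_of_mem hi)),
      ih fun i hi => hg i (mem_insert_of_mem hi)]

theorem pow_sub_one_ne_zero {q a : ℕ} (hq1 : 1 < q) (ha : 0 < a) : (q : ℚ) ^ a - 1 ≠ 0 := by
  have : (1 : ℚ) < (q : ℚ) ^ a := one_lt_pow₀ (by exact_mod_cast hq1) ha.ne'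
  linarith

/-- The number of hooks `h` of `l` with `o ∣ d * |h|`. -/
def scaledHookCount (o d : ℕ) (l : YoungDiagram) : ℕ := #{c ∈ l.cells | o ∣ d * hookLength l c}

theorem scaledHookCount_one_right (o : ℕ) (l : YoungDiagram) :
    scaledHookCount o 1 l = hookDvdCount o l := by
  simp only [scaledHookCount, hookDvdCount, one_mul]

theorem scaledHookCount_one_left (d : ℕ) (l : YoungDiagram) : scaledHookCount 1 d l = l.card := by
  simp only [scaledHookCount, one_dvd, filter_true]

theorem mul_scaledHookCount_le {o d : ℕ} (ho : 0 < o) (hd : 0 < d) (l : YoungDiagram) :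
    o * scaledHookCount o d l ≤ d * l.card := by
  have hg : 0 < o.gcd d := Nat.gcd_pos_of_pos_left d ho
  obtain ⟨e, he⟩ := Nat.gcd_dvd_left o d
  obtain ⟨d', hd'⟩ := Nat.gcd_dvd_right o d
  have hcop : e.Coprime d' := by
    have := Nat.coprime_div_gcd_div_gcd hg
    rwa [Nat.div_eq_of_eq_mul_right hg he, Nat.div_eq_of_eq_mul_right hg hd'] at this
  have hepos : 0 < e := Nat.pos_of_ne_zero fun h => by simp [h] at he; omega
  -- `o ∣ d * h` means that `h` is divisible by `o / gcd o d`
  have hiff : ∀ h, o ∣ d * h ↔ e ∣ h := fun h => by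
    have : o ∣ d * h ↔ o.gcd d * e ∣ o.gcd d * (d' * h) := by rw [← mul_assoc, ← he, ← hd']
    rw [this, Nat.mul_dvd_mul_iff_left hg]
    exact hcop.dvd_mul_left
  have hcount : scaledHookCount o d l = hookDvdCount e l := by
    simp only [scaledHookCount, hookDvdCount, hiff]
  rw [hcount]
  calc o * hookDvdCount e l = o.gcd d * (e * hookDvdCount e l) := by
        rw [← mul_assoc, ← he]
    _ ≤ d * l.card := Nat.mul_le_mul (Nat.gcd_le_right _ hd) (mul_hookDvdCount_le hepos l)

theorem hookFactor_ne_zero {q : ℕ} (hq1 : 1 < q) {d : ℕ} (hd : 0 < d) (l : YoungDiagram) :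
    hookFactor l ((q : ℚ) ^ d) ≠ 0 := by
  have hq0 : (q : ℚ) ≠ 0 := by exact_mod_cast (zero_lt_one.trans hq1).ne'
  refine mul_ne_zero (pow_ne_zero _ (pow_ne_zero _ hq0)) (prod_ne_zero_iff.mpr fun c _ => ?_)
  rw [← pow_mul]
  exact inv_ne_zero (pow_sub_one_ne_zero hq1 (Nat.mul_pos hd (hookLength_pos l c)))

theorem padicValRat_psi {q n J : ℕ} (hq1 : 1 < q) (hJ : q ^ n ≤ 2 ^ J) :
    padicValRat 2 (psi n q) = ∑ j ∈ Icc 1 J, ((n / orderOf (q : ZMod (2 ^ j)) : ℕ) : ℤ) := by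
  rw [psi, padicValRat_prod _ _ fun i hi =>
    pow_sub_one_ne_zero hq1 (zero_lt_one.trans_le (mem_Icc.mp hi).1)]
  have h1 : ∀ i ∈ Icc 1 n, padicValRat 2 ((q : ℚ) ^ i - 1) =
      (#{j ∈ Icc 1 J | orderOf (q : ZMod (2 ^ j)) ∣ i} : ℤ) := fun i hi => by
    rw [mem_Icc] at hi
    exact padicValRat_pow_sub_one hq1 hi.1
      ((Nat.pow_le_pow_right (zero_lt_one.trans hq1) hi.2).trans hJ)
  rw [sum_congr rfl h1]
  norm_cast
  have := sum_card_bipartiteAbove_eq_sum_card_bipartiteBelow (s := Icc 1 n) (t := Icc 1 J)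
    (fun i j => orderOf (q : ZMod (2 ^ j)) ∣ i)
  simp only [bipartiteAbove, bipartiteBelow] at this
  rw [this]
  exact sum_congr rfl fun j _ => Nat.Ioc_filter_dvd_card_eq_div n _

theorem padicValRat_hookFactor {q d J : ℕ} (hq : Odd q) (hq1 : 1 < q) (hd : 0 < d)
    (l : YoungDiagram) (hJ : q ^ (d * l.card) ≤ 2 ^ J) :
    padicValRat 2 (hookFactor l ((q : ℚ) ^ d)) =
      -∑ j ∈ Icc 1 J, (scaledHookCount (orderOf (q : ZMod (2 ^ j))) d l : ℤ) := by
  have hq0 : (q : ℚ) ≠ 0 := by exact_mod_cast hq.pos.ne'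
  have hqval : padicValRat 2 (q : ℚ) = 0 := by
    rw [padicValRat.of_nat, padicValNat.eq_zero_of_not_dvd hq.not_two_dvd_nat, Nat.cast_zero]
  have hne : ∀ c ∈ l.cells, (((q : ℚ) ^ d) ^ hookLength l c - 1)⁻¹ ≠ 0 := fun c _ => by
    rw [← pow_mul]
    exact inv_ne_zero (pow_sub_one_ne_zero hq1 (Nat.mul_pos hd (hookLength_pos l c)))
  rw [hookFactor, padicValRat.mul (pow_ne_zero _ (pow_ne_zero _ hq0)) (prod_ne_zero_iff.mpr hne),
    padicValRat.pow, padicValRat.pow, hqval, mul_zero, mul_zero, zero_add,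
    padicValRat_prod _ _ hne]
  have h1 : ∀ c ∈ l.cells, padicValRat 2 (((q : ℚ) ^ d) ^ hookLength l c - 1)⁻¹ =
      -(#{j ∈ Icc 1 J | orderOf (q : ZMod (2 ^ j)) ∣ d * hookLength l c} : ℤ) := fun c hc => by
    rw [padicValRat.inv, ← pow_mul, padicValRat_pow_sub_one hq1
      (Nat.mul_pos hd (hookLength_pos l c)) ((Nat.pow_le_pow_right hq.pos
        (Nat.mul_le_mul_left d (hookLength_le_card hc))).trans hJ)]
  rw [sum_congr rfl h1, sum_neg_distrib]
  congr 1
  norm_cast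
  have := sum_card_bipartiteAbove_eq_sum_card_bipartiteBelow (s := l.cells) (t := Icc 1 J)
    (fun c j => orderOf (q : ZMod (2 ^ j)) ∣ d * hookLength l c)
  simp only [bipartiteAbove, bipartiteBelow] at this
  exact this

/-- Counting the factors `q ^ i - 1` divisible by `2 ^ j` for each `j ≥ 1` writes the valuation as a
sum of terms `n / o - ∑ f, scaledHookCount o (d f) (l f)`, one for each order `o` of `q` modulo
`2 ^ j`. All of them are nonnegative, and every power of two occurs among the orders, so each power
of two gives a lower bound. -/
theorem div_two_pow_sub_le_padicValRat {ι : Type*} {q n : ℕ} (hq : Odd q) (hq1 : 1 < q)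
    (S : Finset ι) (d : ι → ℕ) (hd : ∀ f, 0 < d f) (l : ι → YoungDiagram)
    (hn : ∑ f ∈ S, d f * (l f).card = n) (i : ℕ) :
    ((n / 2 ^ i : ℕ) : ℤ) - ∑ f ∈ S, (scaledHookCount (2 ^ i) (d f) (l f) : ℤ) ≤
      padicValRat 2 (psi n q * ∏ f ∈ S, hookFactor (l f) ((q : ℚ) ^ d f)) := by
  obtain ⟨j₀, hj₀, hord⟩ := exists_orderOf_eq_two_pow hq hq1 i
  set J := max j₀ (q ^ n) with hJdef
  have hJ : q ^ n ≤ 2 ^ J := (le_max_right j₀ (q ^ n)).trans (Nat.lt_two_pow_self).le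
  have hle : ∀ f ∈ S, d f * (l f).card ≤ n := fun f hf => by
    rw [← hn]
    exact single_le_sum (f := fun f => d f * (l f).card) (fun _ _ => Nat.zero_le _) hf
  have hpsi : psi n (q : ℚ) ≠ 0 := prod_ne_zero_iff.mpr fun a ha =>
    pow_sub_one_ne_zero hq1 (zero_lt_one.trans_le (mem_Icc.mp ha).1)
  have hval : ∀ f ∈ S, padicValRat 2 (hookFactor (l f) ((q : ℚ) ^ d f)) =
      -∑ j ∈ Icc 1 J, (scaledHookCount (orderOf (q : ZMod (2 ^ j))) (d f) (l f) : ℤ) :=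
    fun f hf => padicValRat_hookFactor hq hq1 (hd f) (l f)
      ((Nat.pow_le_pow_right hq.pos (hle f hf)).trans hJ)
  rw [padicValRat.mul hpsi (prod_ne_zero_iff.mpr fun f _ => hookFactor_ne_zero hq1 (hd f) _),
    padicValRat_psi hq1 hJ, padicValRat_prod _ _ fun f _ => hookFactor_ne_zero hq1 (hd f) _,
    sum_congr rfl hval, sum_neg_distrib, sum_comm, ← sub_eq_add_neg, ← sum_sub_distrib, ← hord]
  refine single_le_sum (f := fun j => ((n / orderOf (q : ZMod (2 ^ j)) : ℕ) : ℤ) -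
    ∑ f ∈ S, (scaledHookCount (orderOf (q : ZMod (2 ^ j))) (d f) (l f) : ℤ)) (fun j _ => ?_)
    (mem_Icc.mpr ⟨hj₀, le_max_left _ _⟩)
  have ho := orderOf_two_pow_pos hq j
  rw [sub_nonneg]
  norm_cast
  rw [Nat.le_div_iff_mul_le ho, mul_comm, mul_sum, ← hn]
  exact sum_le_sum fun f _ => mul_scaledHookCount_le ho (hd f) (l f)

/-- The contribution of the prime `2` itself to the valuation. -/
theorem sub_sum_card_le_padicValRat {ι : Type*} {q n : ℕ} (hq : Odd q) (hq1 : 1 < q)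
    (S : Finset ι) (d : ι → ℕ) (hd : ∀ f, 0 < d f) (l : ι → YoungDiagram)
    (hn : ∑ f ∈ S, d f * (l f).card = n) :
    (n : ℤ) - ∑ f ∈ S, ((l f).card : ℤ) ≤
      padicValRat 2 (psi n q * ∏ f ∈ S, hookFactor (l f) ((q : ℚ) ^ d f)) := by
  simpa [scaledHookCount_one_left] using div_two_pow_sub_le_padicValRat hq hq1 S d hd l hn 0

/-- A single component of degree one already bounds the valuation from below, by the number of
integers in `[1, |l f₀|]` divisible by `2 ^ i` minus the number of such hook lengths of `l f₀`. -/
theorem card_div_two_pow_sub_le_padicValRat {ι : Type*} {q n : ℕ} (hq : Odd q) (hq1 : 1 < q)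
    (S : Finset ι) (d : ι → ℕ) (hd : ∀ f, 0 < d f) (l : ι → YoungDiagram)
    (hn : ∑ f ∈ S, d f * (l f).card = n) {f₀ : ι} (hf₀ : f₀ ∈ S) (hd₀ : d f₀ = 1) (i : ℕ) :
    (((l f₀).card / 2 ^ i : ℕ) : ℤ) - hookDvdCount (2 ^ i) (l f₀) ≤
      padicValRat 2 (psi n q * ∏ f ∈ S, hookFactor (l f) ((q : ℚ) ^ d f)) := by
  classical
  refine le_trans ?_ (div_two_pow_sub_le_padicValRat hq hq1 S d hd l hn i)
  have ho := Nat.two_pow_pos i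
  have hrest : 2 ^ i * ∑ f ∈ S.erase f₀, scaledHookCount (2 ^ i) (d f) (l f) ≤
      ∑ f ∈ S.erase f₀, d f * (l f).card := by
    rw [mul_sum]
    exact sum_le_sum fun f _ => mul_scaledHookCount_le ho (hd f) (l f)
  have hn' : (l f₀).card + ∑ f ∈ S.erase f₀, d f * (l f).card = n := by
    rw [← hn, ← add_sum_erase _ _ hf₀, hd₀, one_mul]
  have h1 : (l f₀).card / 2 ^ i + ∑ f ∈ S.erase f₀, scaledHookCount (2 ^ i) (d f) (l f) ≤
      n / 2 ^ i := by
    rw [← Nat.add_mul_div_left _ _ ho]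
    exact Nat.div_le_div_right (by omega)
  rw [← add_sum_erase _ _ hf₀, hd₀, scaledHookCount_one_right]
  have h2 : (((l f₀).card / 2 ^ i : ℕ) : ℤ) +
      ∑ f ∈ S.erase f₀, (scaledHookCount (2 ^ i) (d f) (l f) : ℤ) ≤ ((n / 2 ^ i : ℕ) : ℤ) := by
    exact_mod_cast h1
  linarith

end GreenGL

/-! ### Partition-valued functions of a fixed type -/

namespace GreenGL

open Finset Polynomial

theorem Phi.dual_dual {K : Type*} [Field K] (f : Phi K) : f.dual.dual = f := by
  have h0 := f.coeff_zero_ne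
  have hdeg : f.1.reverse.natDegree = f.1.natDegree := by
    rw [reverse_natDegree, natTrailingDegree_eq_zero.mpr (Or.inr h0), Nat.sub_zero]
  have hrr : f.1.reverse.reverse = f.1 := by
    ext i
    rw [coeff_reverse, coeff_reverse, hdeg, revAt_invol]
  apply Subtype.ext
  change C ((C (f.1.coeff 0)⁻¹ * f.1.reverse).coeff 0)⁻¹ * (C (f.1.coeff 0)⁻¹ * f.1.reverse).reverse
    = f.1
  rw [reverse_mul_of_domain, hrr, reverse_C, mul_coeff_zero, coeff_C_zero, coeff_zero_reverse,
    f.2.1.leadingCoeff, mul_one, inv_inv, ← mul_assoc, ← C_mul, mul_inv_cancel₀ h0, C_1, one_mul]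

theorem HasWeight.sum_toFinset {K : Type*} [Field K] {n : ℕ} {F : Phi K → ℕ} (h : HasWeight n F) :
    ∑ f ∈ h.1.toFinset, f.deg * F f = n := by
  refine Eq.trans (finsum_eq_sum_of_support_subset _ fun f hf => ?_).symm h.2
  rw [Set.Finite.coe_toFinset]
  exact right_ne_zero_of_mul (Function.mem_support.mp hf)

theorem hookFactor_eq_one {l : YoungDiagram} (h : l.card = 0) (x : ℚ) : hookFactor l x = 1 := by
  obtain rfl : l = ⊥ := YoungDiagram.ext (card_eq_zero.mp h)
  have : (⊥ : YoungDiagram).colLen 0 = 0 := Nat.le_zero.mp (colLen_zero_le_card ⊥)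
  simp [hookFactor, alpha, this]

theorem greenDegree_eq_prod {K : Type*} [Field K] {n : ℕ} {μ : Phi K → YoungDiagram}
    (h : HasWeight n fun f => (μ f).card) :
    greenDegree n μ =
      psi n (Nat.card K) * ∏ f ∈ h.1.toFinset, hookFactor (μ f) ((Nat.card K : ℚ) ^ f.deg) := by
  rw [greenDegree]
  congr 1
  refine finprod_eq_prod_of_mulSupport_subset _ fun f hf => ?_
  rw [Set.Finite.coe_toFinset]
  exact fun h0 => hf (hookFactor_eq_one h0 _)

theorem finite_selfDual (K : Type*) [Field K] [Finite K] (n : ℕ) : (selfDual K n).Finite :=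
  (finite_partFuns K n).subset fun _ h => h.1

theorem finite_fiber {K : Type*} [Field K] [Finite K] (n : ℕ) (F : Phi K → ℕ) :
    (fiber n F).Finite :=
  (finite_selfDual K n).subset fun _ h => h.1

/-- Replace the value of `μ` at `f₀` and at its dual by `l`. -/
noncomputable def replaceAt {K : Type*} [Field K] (f₀ : Phi K) (μ : Phi K → YoungDiagram)
    (l : YoungDiagram) : Phi K → YoungDiagram :=
  open scoped Classical in fun f => if f = f₀ ∨ f = f₀.dual then l else μ f

theorem replaceAt_self {K : Type*} [Field K] (f₀ : Phi K) (μ : Phi K → YoungDiagram)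
    (l : YoungDiagram) : replaceAt f₀ μ l f₀ = l := if_pos (Or.inl rfl)

theorem replaceAt_replaceAt {K : Type*} [Field K] {f₀ : Phi K} {μ : Phi K → YoungDiagram}
    (h : ∀ f, μ f = μ f.dual) (l : YoungDiagram) :
    replaceAt f₀ (replaceAt f₀ μ l) (μ f₀) = μ := by
  funext f
  simp only [replaceAt]
  split_ifs with hf
  · rcases hf with rfl | rfl
    · rfl
    · exact h f₀
  · rfl

theorem replaceAt_mem_fiber {K : Type*} [Field K] {n : ℕ} {F : Phi K → ℕ} {f₀ : Phi K}
    {μ : Phi K → YoungDiagram} (hμ : μ ∈ fiber n F) {l : YoungDiagram} (hl : l.card = F f₀) :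
    replaceAt f₀ μ l ∈ fiber n F := by
  have hcard : ∀ f, (replaceAt f₀ μ l f).card = F f := by
    intro f
    simp only [replaceAt]
    split_ifs with hf
    · rcases hf with rfl | rfl
      · exact hl
      · rw [← hμ.2, ← hμ.1.2, hμ.2, hl]
    · exact hμ.2 f
  refine ⟨⟨?_, fun f => ?_⟩, hcard⟩
  · have h1 : HasWeight n fun f => (μ f).card := hμ.1.1
    have h2 : (fun f => (replaceAt f₀ μ l f).card) = fun f => (μ f).card := by
      funext f
      rw [hcard, hμ.2]
    change HasWeight n fun f => (replaceAt f₀ μ l f).card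
    rwa [h2]
  · have hiff : (f.dual = f₀ ∨ f.dual = f₀.dual) ↔ (f = f₀ ∨ f = f₀.dual) := by
      constructor
      · rintro (rfl | h)
        · exact Or.inr f.dual_dual.symm
        · exact Or.inl (by rw [← f.dual_dual, h, f₀.dual_dual])
      · rintro (rfl | rfl)
        · exact Or.inr rfl
        · exact Or.inl f₀.dual_dual
    by_cases hf : f = f₀ ∨ f = f₀.dual
    · exact (if_pos hf).trans (if_pos (hiff.mpr hf)).symm
    · exact (if_neg hf).trans ((hμ.1.2 f).trans (if_neg fun h => hf (hiff.mp h)).symm)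

/-- In a fibre, the value at `f₀` is uniformly distributed among the partitions of `F f₀`. -/
theorem ncard_fiber_mul_le {K : Type*} [Field K] [Finite K] (n : ℕ) (F : Phi K → ℕ) (f₀ : Phi K)
    {A : Set YoungDiagram} (hA : A ⊆ partitionsOf (F f₀)) :
    {μ ∈ fiber n F | μ f₀ ∈ A}.ncard * (partitionsOf (F f₀)).ncard ≤
      (fiber n F).ncard * A.ncard := by
  rw [← Set.ncard_prod, ← Set.ncard_prod]
  refine Set.ncard_le_ncard_of_injOn (fun p => (replaceAt f₀ p.1 p.2, p.1 f₀)) ?_ ?_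
    ((finite_fiber n F).prod ((finite_partitionsOf _).subset hA))
  · rintro ⟨μ, l⟩ ⟨h1, h2⟩
    exact ⟨replaceAt_mem_fiber h1.1 h2, h1.2⟩
  · rintro ⟨μ, l⟩ ⟨h1, -⟩ ⟨μ', l'⟩ ⟨h1', -⟩ h
    obtain ⟨ha, hb⟩ := Prod.ext_iff.mp h
    simp only at ha hb
    have hl : l = l' := by
      rw [← replaceAt_self f₀ μ l, ha, replaceAt_self]
    have hμ : μ = μ' := by
      have h2 : ∀ f, μ f = μ f.dual := h1.1.1.2
      have h2' : ∀ f, μ' f = μ' f.dual := h1'.1.1.2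
      rw [← replaceAt_replaceAt (f₀ := f₀) h2 l, ha, hb, replaceAt_replaceAt h2']
    rw [hl, hμ]

/-! ### Scarcity of degrees of small 2-adic valuation -/

theorem padicValRat_descFactorial_lt {n k u : ℕ} (hn : 0 < n) (hu : n ^ k < 2 ^ u) :
    padicValRat 2 (n.descFactorial k : ℚ) < u := by
  rw [padicValRat.of_nat]
  have h1 : padicValNat 2 (n.descFactorial k) ≤ Nat.log 2 (n.descFactorial k) :=
    padicValNat_le_nat_log _
  have h2 : Nat.log 2 (n.descFactorial k) ≤ Nat.log 2 (n ^ k) :=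
    Nat.log_mono_right (Nat.descFactorial_le_pow n k)
  have h3 : Nat.log 2 (n ^ k) < u := Nat.log_lt_of_lt_pow (Nat.pow_pos hn).ne' hu
  exact_mod_cast (h1.trans h2).trans_lt h3

/-- A type of weight `n` and total multiplicity close to `n` takes a value proportional to `n` at
some polynomial of degree one, because there are boundedly many of these. -/
theorem exists_deg_one_of_lt_sum {K : Type*} [Field K] [Finite K] {n u : ℕ} {F : Phi K → ℕ}
    (h : HasWeight n F) (hu : 4 * u ≤ n) (hlt : n < ∑ f ∈ h.1.toFinset, F f + u) :
    ∃ f₀ : Phi K, f₀.deg = 1 ∧ n < 2 * (finite_deg_le K 1).toFinset.card * F f₀ := by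
  classical
  set c := (finite_deg_le K 1).toFinset.card
  set S := h.1.toFinset
  set T := {f ∈ S | f.deg = 1} with hT
  have h1 : 2 * ∑ f ∈ S, F f ≤ n + ∑ f ∈ T, F f := by
    rw [← h.sum_toFinset, hT, sum_filter, ← sum_add_distrib, mul_sum]
    refine sum_le_sum fun f _ => ?_
    have := f.deg_pos
    split_ifs with hf
    · rw [hf]
      omega
    · have : 2 ≤ f.deg := by omega
      nlinarith
  have hTc : #T ≤ c := card_le_card fun f hf => by
    rw [Set.Finite.mem_toFinset]
    exact (mem_filter.mp hf).2.le
  by_contra! hno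
  have h2 : 2 * c * ∑ f ∈ T, F f ≤ c * n := by
    rw [mul_sum]
    refine (sum_le_card_nsmul T _ n fun f hf => hno f (mem_filter.mp hf).2).trans ?_
    exact Nat.mul_le_mul_right n hTc
  have h3 : n < 2 * ∑ f ∈ T, F f := by omega
  have hc : 0 < c := by
    refine lt_of_lt_of_le (card_pos.mpr ?_) hTc
    by_contra hne
    rw [not_nonempty_iff_eq_empty.mp hne, sum_empty] at h3
    omega
  have := Nat.mul_lt_mul_of_pos_left h3 hc
  linarith

theorem exists_pow_ten_le (m : ℕ) : ∃ t, t ^ 10 ≤ m ∧ m < (t + 1) ^ 10 := by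
  have hex : ∃ t, m < (t + 1) ^ 10 :=
    ⟨m, (Nat.lt_succ_self m).trans_le (Nat.le_self_pow (by norm_num) _)⟩
  classical
  refine ⟨Nat.find hex, ?_, Nat.find_spec hex⟩
  rcases Nat.eq_zero_or_pos (Nat.find hex) with h0 | hpos
  · rw [h0]
    simp
  · have := Nat.find_min hex (m := Nat.find hex - 1) (by omega)
    rwa [Nat.sub_add_cancel hpos, not_lt] at this

theorem IsBad.smallDurfee {K : Type*} [Field K] [Finite K] (hq : Odd (Nat.card K)) {n k t : ℕ}
    {F : Phi K → ℕ} {μ : Phi K → YoungDiagram} (hμ : μ ∈ fiber n F) (hbad : IsBad n k μ)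
    (hn : 0 < n) {f₀ : Phi K} (hf₀ : f₀.deg = 1) (ht : 32768 ≤ t) (h1 : t ^ 10 ≤ F f₀)
    (h2 : F f₀ < (t + 1) ^ 10) (hnt : n ^ k < 2 ^ t) :
    μ f₀ ∈ smallDurfee (F f₀) (t ^ 4 - 1) := by
  refine ⟨hμ.2 f₀, fun hd => ?_⟩
  obtain ⟨i, hi⟩ := exists_add_hookDvdCount_le ht h1 h2 (hμ.2 f₀) hd
  have hw : HasWeight n fun f => (μ f).card := hμ.1.1
  have hmem : f₀ ∈ hw.1.toFinset := by
    rw [Set.Finite.mem_toFinset, Function.mem_support, hμ.2]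
    have : 0 < t ^ 10 := Nat.pow_pos (by omega)
    omega
  have h3 := card_div_two_pow_sub_le_padicValRat hq Finite.one_lt_card hw.1.toFinset Phi.deg
    Phi.deg_pos μ hw.sum_toFinset hmem hf₀ i
  rw [← greenDegree_eq_prod hw, hμ.2] at h3
  have h4 := hbad.trans (padicValRat_descFactorial_lt hn hnt)
  have h5 : (t : ℤ) + hookDvdCount (2 ^ i) (μ f₀) ≤ ((F f₀ / 2 ^ i : ℕ) : ℤ) := by
    exact_mod_cast hi
  linarith

theorem IsBad.lt_sum {K : Type*} [Field K] [Finite K] (hq : Odd (Nat.card K)) {n k u : ℕ}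
    {F : Phi K → ℕ} (hF : HasWeight n F) {μ : Phi K → YoungDiagram} (hμ : μ ∈ fiber n F)
    (hbad : IsBad n k μ) (hn : 0 < n) (hnu : n ^ k < 2 ^ u) :
    n < ∑ f ∈ hF.1.toFinset, F f + u := by
  have hFμ : (fun f => (μ f).card) = F := funext hμ.2
  subst hFμ
  have h3 := sub_sum_card_le_padicValRat hq Finite.one_lt_card hF.1.toFinset Phi.deg
    Phi.deg_pos μ hF.sum_toFinset
  rw [← greenDegree_eq_prod hF] at h3
  have h4 := hbad.trans (padicValRat_descFactorial_lt hn hnu)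
  have h5 : (n : ℤ) < ∑ f ∈ hF.1.toFinset, ((μ f).card : ℤ) + u := by linarith
  exact_mod_cast h5

/-- The proportion of bad elements is small in all fibres over `𝒢_n(Φ)` at once: a single `N` serves
every type, since the size of `F f₀` enters only through a lower bound proportional to `n`. -/
theorem exists_forall_ncard_fiber_isBad_lt {K : Type*} [Field K] [Finite K]
    (hq : Odd (Nat.card K)) (k : ℕ) {ε : ℝ} (hε : 0 < ε) :
    ∃ N : ℕ, ∀ n : ℕ, N ≤ n → ∀ F ∈ types K n,
      ({μ ∈ fiber n F | IsBad n k μ}.ncard : ℝ) / ((fiber n F).ncard : ℝ) < ε := by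
  set c := (finite_deg_le K 1).toFinset.card
  obtain ⟨T, hT⟩ := Filter.eventually_atTop.mp (((eventually_ncard_smallDurfee_lt hε).and
    (eventually_mul_pow_lt_two_pow ((2 * c) ^ k) (10 * k))).and
    (Filter.eventually_ge_atTop 32768))
  obtain ⟨U, hU⟩ := Filter.eventually_atTop.mp (eventually_mul_pow_lt_two_pow (4 ^ k) k)
  refine ⟨4 * U + 2 * c * T ^ 10 + 1, fun n hn F hF => ?_⟩
  have hn0 : 0 < n := by omega
  by_cases hempty : {μ ∈ fiber n F | IsBad n k μ} = ∅
  · rw [hempty, Set.ncard_empty, Nat.cast_zero, zero_div]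
    exact hε
  obtain ⟨μ₀, hμ₀, hbad₀⟩ := Set.nonempty_iff_ne_empty.mpr hempty
  have hnu : n ^ k < 2 ^ (n / 4) := by
    refine lt_of_le_of_lt ?_ (hU (n / 4) (by omega))
    rw [← mul_pow]
    exact Nat.pow_le_pow_left (by omega) k
  -- a single bad element of the fibre forces the weight of `F` onto polynomials of degree one
  obtain ⟨f₀, hf₀, hlarge⟩ := exists_deg_one_of_lt_sum hF.1 (by omega)
    (IsBad.lt_sum hq hF.1 hμ₀ hbad₀ hn0 hnu)
  change n < 2 * c * F f₀ at hlarge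
  obtain ⟨t, ht1, ht2⟩ := exists_pow_ten_le (F f₀)
  have hTF : T ^ 10 ≤ F f₀ := by
    by_contra! hlt
    have := Nat.mul_le_mul_left (2 * c) hlt.le
    omega
  have hTt : T ≤ t := by
    have := lt_of_pow_lt_pow_left₀ 10 (Nat.zero_le _) (hTF.trans_lt ht2)
    omega
  obtain ⟨⟨hsmall, hpow⟩, ht⟩ := hT t hTt
  have hnt : n ^ k < 2 ^ t := by
    refine lt_of_le_of_lt ?_ hpow
    rw [pow_mul, ← mul_pow]
    exact Nat.pow_le_pow_left (hlarge.le.trans (Nat.mul_le_mul_left _ ht2.le)) k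
  have hsub : {μ ∈ fiber n F | IsBad n k μ} ⊆
      {μ ∈ fiber n F | μ f₀ ∈ smallDurfee (F f₀) (t ^ 4 - 1)} := fun μ hμ =>
    ⟨hμ.1, IsBad.smallDurfee hq hμ.1 hμ.2 hn0 hf₀ ht ht1 ht2 hnt⟩
  have hle := Set.ncard_le_ncard hsub ((finite_fiber n F).subset fun _ h => h.1)
  have hprod := ncard_fiber_mul_le n F f₀ (A := smallDurfee (F f₀) (t ^ 4 - 1)) fun _ h => h.1
  have hsm := hsmall (F f₀) ht1 ht2
  have hfib : (0 : ℝ) < (fiber n F).ncard := by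
    exact_mod_cast (Set.ncard_pos (finite_fiber n F)).mpr ⟨μ₀, hμ₀⟩
  have hpar : (0 : ℝ) < (partitionsOf (F f₀)).ncard := by
    by_contra! hneg
    have h0 : (0 : ℝ) ≤ (smallDurfee (F f₀) (t ^ 4 - 1)).ncard := Nat.cast_nonneg _
    nlinarith
  rw [div_lt_iff₀ hfib]
  have hprod' : ({μ ∈ fiber n F | IsBad n k μ}.ncard : ℝ) * (partitionsOf (F f₀)).ncard ≤
      (fiber n F).ncard * (smallDurfee (F f₀) (t ^ 4 - 1)).ncard := by
    exact_mod_cast (Nat.mul_le_mul_right _ hle).trans hprod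
  refine lt_of_mul_lt_mul_right (lt_of_le_of_lt hprod' ?_) hpar.le
  calc ((fiber n F).ncard : ℝ) * (smallDurfee (F f₀) (t ^ 4 - 1)).ncard
      < (fiber n F).ncard * (ε * (partitionsOf (F f₀)).ncard) := mul_lt_mul_of_pos_left hsm hfib
    _ = ε * (fiber n F).ncard * (partitionsOf (F f₀)).ncard := by ring

/-- `𝔜_n` is the disjoint union of the fibres, so a bound valid in every fibre is valid in `𝔜_n`. -/
theorem ncard_selfDual_isBad_le {K : Type*} [Field K] [Finite K] {n k : ℕ} {ε : ℝ}
    (h : ∀ F ∈ types K n,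
      ({μ ∈ fiber n F | IsBad n k μ}.ncard : ℝ) / ((fiber n F).ncard : ℝ) < ε) :
    ({μ ∈ selfDual K n | IsBad n k μ}.ncard : ℝ) ≤ ε * (selfDual K n).ncard := by
  classical
  set Y := (finite_selfDual K n).toFinset with hY
  have hYmem : ∀ μ, μ ∈ Y ↔ μ ∈ selfDual K n := fun μ => Set.Finite.mem_toFinset _
  let τ : (Phi K → YoungDiagram) → Phi K → ℕ := fun μ f => (μ f).card
  have hfib : ∀ F, fiber n F = ({μ ∈ Y | τ μ = F} : Finset _) := fun F => by
    ext μ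
    simp only [mem_coe, mem_filter, hYmem]
    exact and_congr_right fun _ => funext_iff.symm
  have hfibB : ∀ F, {μ ∈ fiber n F | IsBad n k μ} =
      ({μ ∈ {μ ∈ Y | IsBad n k μ} | τ μ = F} : Finset _) := fun F => by
    ext μ
    rw [hfib]
    simp only [Set.mem_ofPred_eq, mem_coe, mem_filter]
    tauto
  have hYB : {μ ∈ selfDual K n | IsBad n k μ} = ({μ ∈ Y | IsBad n k μ} : Finset _) := by
    ext μ
    simp only [Set.mem_ofPred_eq, mem_coe, mem_filter, hYmem]
  have hYY : selfDual K n = (Y : Set _) := (Set.Finite.coe_toFinset _).symm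
  have hmaps : ∀ μ ∈ Y, τ μ ∈ Y.image τ := fun μ hμ => mem_image_of_mem _ hμ
  rw [hYB, hYY, Set.ncard_coe_finset, Set.ncard_coe_finset,
    card_eq_sum_card_fiberwise (f := τ) (s := Y) (t := Y.image τ) hmaps,
    card_eq_sum_card_fiberwise (f := τ) (s := {μ ∈ Y | IsBad n k μ}) (t := Y.image τ)
      (fun μ hμ => hmaps μ (mem_filter.mp hμ).1)]
  push_cast
  rw [mul_sum]
  refine sum_le_sum fun F hF => ?_
  obtain ⟨μ, hμ, rfl⟩ := mem_image.mp hF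
  have hμ' := (hYmem μ).mp hμ
  have hr := h (τ μ) ⟨hμ'.1, fun f => congrArg YoungDiagram.card (hμ'.2 f).symm⟩
  rw [hfibB, hfib, Set.ncard_coe_finset, Set.ncard_coe_finset] at hr
  have hpos : (0 : ℝ) < (#{μ' ∈ Y | τ μ' = τ μ} : ℝ) := by
    exact Nat.cast_pos.mpr (card_pos.mpr ⟨μ, mem_filter.mpr ⟨hμ, rfl⟩⟩)
  exact ((div_lt_iff₀ hpos).mp hr).le

end GreenGL

theorem mainTheorem4 {K : Type*} [Field K] [Finite K] (hq : Odd (Nat.card K)) (k : ℕ) :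
    (∀ ε : ℝ, 0 < ε → ∃ N : ℕ, ∀ n : ℕ, N ≤ n → ∀ F ∈ GreenGL.types K n,
      ({μ ∈ GreenGL.fiber n F | GreenGL.IsBad n k μ}.ncard : ℝ) /
        ((GreenGL.fiber n F).ncard : ℝ) < ε) ∧
    Filter.Tendsto
      (fun n : ℕ => ({μ ∈ GreenGL.selfDual K n | GreenGL.IsBad n k μ}.ncard : ℝ) /
        ((GreenGL.selfDual K n).ncard : ℝ))
      Filter.atTop (nhds 0) := by
  refine ⟨fun ε hε => GreenGL.exists_forall_ncard_fiber_isBad_lt hq k hε, ?_⟩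
  rw [Metric.tendsto_atTop]
  intro ε hε
  obtain ⟨N, hN⟩ := GreenGL.exists_forall_ncard_fiber_isBad_lt (K := K) hq k (half_pos hε)
  refine ⟨N, fun n hn => ?_⟩
  rw [Real.dist_0_eq_abs, abs_of_nonneg (by positivity)]
  refine lt_of_le_of_lt ?_ (half_lt_self hε)
  exact div_le_of_le_mul₀ (Nat.cast_nonneg _) (half_pos hε).le
    (GreenGL.ncard_selfDual_isBad_le (hN n hn))
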